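/- Let $d\ge 1$ and let $\ell:\mathbb R^d\to[0,\infty)$ be bounded with $\int_{\mathbb R^d}\ell(x)\,dx<\infty$. Let $F_P$ be a distribution function on $[0,\infty)$ with finite mean whose tail $\bar F_P=1-F_P$ is regularly varying at infinity with index $-\alpha$ for some $\alpha\in(1,2)$, i.e. $\lim_{t\to\infty}\bar F_P(ct)/\bar F_P(t)=c^{-\alpha}$ for every $c>0$. Let $g$ be an asymptotic inverse of $f=1/\bar F_P$, i.e. $f(g(x))\sim g(f(x))\sim x$ as $x\to\infty$. For every $\lambda>0$ let $\Phi_\lambda=\sum_{n\ge1}\delta_{X_n}$ be a homogeneous Poisson point process on $\mathbb R^d$ with intensity $\lambda$, let $P_1,P_2,\dots$ be i.i.d. random variables with distribution function $F_P$, independent of $(X_n)_{n\ge1}$, and put $$I_\lambda(z)=\sum_{n\ge1}P_n\,\ell(z-X_n),\qquad \tilde I_\lambda(z)=\frac{I_\lambda(z)-\mathbb E[I_\lambda(z)]}{g(\lambda)},\qquad z\in\mathbb R^d.$$ Then $g$ is regularly varying with index $1/\alpha$; for each $\lambda$ and $z$ the series $I_\lambda(z)$ converges almost surely and has finite mean;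 and, as $\lambda\to\infty$, $\{\tilde I_\lambda(z)\}_{z\in\mathbb R^d}$ converges in finite-dimensional distributions to an $\alpha$-stable random field $\{S(z)\}_{z\in\mathbb R^d}$ with the (finite) Laplace transform $$\mathbb E\Bigl[\exp\Bigl(-\sum_{j=1}^m s_j S(z_j)\Bigr)\Bigr]=\exp\Bigl(\frac{\Gamma(2-\alpha)}{\alpha-1}\int_{\mathbb R^d}\Bigl[\sum_{j=1}^m s_j\,\ell(z_j-x)\Bigr]^{\alpha}dx\Bigr)$$ for all $m\in\mathbb N$, $s_1,\dots,s_m\ge0$ and $z_1,\dots,z_m\in\mathbb R^d$, where the integral on the right-hand side is finite. (A random field is $\alpha$-stable if all its finite-dimensional distributions are: for independent copies $Y_1,Y_2$ of $Y=(S(z_1),\dots,S(z_m))$ and $A,B>0$, $AY_1+BY_2$ has the law of $(A^\alpha+B^\alpha)^{1/\alpha}Y+D$ for some $D\in\mathbb R^m$; constants are allowed.) -/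

import Mathlib

open MeasureTheory ProbabilityTheory Filter Topology Asymptotics

/-- The random counting measure `∑ₙ δ_{Xₙ}` of a sequence of random points. -/
noncomputable def pointMeasure {Ω E : Type*} [MeasurableSpace E]
    (X : ℕ → Ω → E) (ω : Ω) : Measure E :=
  Measure.sum fun n => Measure.dirac (X n ω)

/-- The random points `Xₙ` form a homogeneous Poisson point process with intensity `lam`:
the number of points in a Borel set `B` of finite volume is Poisson distributed with mean
`lam * vol B`, and the numbers of points in pairwise disjoint sets are independent. -/
structure IsHomogeneousPoisson {Ω : Type*} [MeasurableSpace Ω] {d : ℕ}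
    (X : ℕ → Ω → EuclideanSpace ℝ (Fin d)) (lam : ℝ) (μ : Measure Ω) : Prop where
  measurable : ∀ n, Measurable (X n)
  poisson : ∀ B : Set (EuclideanSpace ℝ (Fin d)), MeasurableSet B → volume B < ⊤ →
    ∀ k : ℕ, μ {ω | pointMeasure X ω B = (k : ENNReal)}
      = poissonMeasure (Real.toNNReal (lam * volume.real B)) {k}
  indep : ∀ (m : ℕ) (B : Fin m → Set (EuclideanSpace ℝ (Fin d))),
    (∀ i, MeasurableSet (B i)) → (∀ i, volume (B i) < ⊤) →
    (Pairwise fun i j => Disjoint (B i) (B j)) →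
    iIndepFun (fun i ω => pointMeasure X ω (B i)) μ

/-- The shot-noise field `I(z) = ∑ₙ Pₙ ℓ(z - Xₙ)`. -/
noncomputable def shotNoise {Ω E : Type*} [AddCommGroup E]
    (ell : E → ℝ) (P : ℕ → Ω → ℝ) (X : ℕ → Ω → E) (z : E) (ω : Ω) : ℝ :=
  ∑' n, P n ω * ell (z - X n ω)

/-- The centred shot-noise field, divided by the number `a`. -/
noncomputable def scaledShotNoise {Ω E : Type*} [MeasurableSpace Ω] [AddCommGroup E]
    (ell : E → ℝ) (P : ℕ → Ω → ℝ) (X : ℕ → Ω → E) (μ : Measure Ω) (a : ℝ)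
    (z : E) (ω : Ω) : ℝ :=
  (shotNoise ell P X z ω - ∫ ω', shotNoise ell P X z ω' ∂μ) / a

/-- The tail `1 - F` of the distribution function `F` of a law on `ℝ`. -/
noncomputable def tail (ν : Measure ℝ) (t : ℝ) : ℝ := 1 - cdf ν t

/-- Regular variation at infinity with index `ρ`. -/
def IsRegularlyVarying (f : ℝ → ℝ) (ρ : ℝ) : Prop :=
  (∀ᶠ t in atTop, 0 < f t) ∧
    ∀ c : ℝ, 0 < c → Tendsto (fun t => f (c * t) / f t) atTop (𝓝 (c ^ ρ))

/-- `g` is an asymptotic inverse of `f`: `f (g x) ∼ g (f x) ∼ x` as `x → ∞`. -/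
def IsAsymptoticInverse (g f : ℝ → ℝ) : Prop :=
  (fun x => f (g x)) ~[atTop] (fun x => x) ∧ (fun x => g (f x)) ~[atTop] (fun x => x)

/-- A law on `ℝᵐ` is `α`-stable: if `Y, Y₁, Y₂` are independent with this law then, for all
`A, B > 0`, `A Y₁ + B Y₂` has the law of `(A ^ α + B ^ α) ^ (1 / α) Y + D` for a constant
vector `D`. -/
def IsStableLaw {m : ℕ} (α : ℝ) (ν : Measure (Fin m → ℝ)) : Prop :=
  ∀ A B : ℝ, 0 < A → 0 < B → ∃ D : Fin m → ℝ,
    (ν.prod ν).map (fun p => A • p.1 + B • p.2)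
      = ν.map (fun y => ((A ^ α + B ^ α) ^ (1 / α)) • y + D)

/-- An `α`-stable random field: all finite-dimensional distributions are `α`-stable. -/
def IsStableField {Ω T : Type*} [MeasurableSpace Ω] (α : ℝ) (S : T → Ω → ℝ)
    (μ : Measure Ω) : Prop :=
  ∀ (m : ℕ) (z : Fin m → T), IsStableLaw α (μ.map fun ω j => S (z j) ω)

/-- Convergence of random fields in finite-dimensional distributions. -/
def TendstoInFDD {ι T Ω' : Type*} {Ω : ι → Type*} [∀ i, MeasurableSpace (Ω i)]
    [MeasurableSpace Ω'] (Y : ∀ i, T → Ω i → ℝ) (l : Filter ι) (S : T → Ω' → ℝ)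
    (μ : ∀ i, Measure (Ω i)) [∀ i, IsProbabilityMeasure (μ i)]
    (μ' : Measure Ω') [IsProbabilityMeasure μ'] : Prop :=
  ∀ (m : ℕ) (z : Fin m → T),
    TendstoInDistribution (fun i ω j => Y i (z j) ω) l (fun ω j => S (z j) ω) μ μ'

/-!
# Normalised shot noise with heavy-tailed amplitudes converges to a stable field

For a marked Poisson process with points in `ℝᵈ` of intensity `λ` and marks of law `ν`, and an
integrable weight `w` with nonnegative real part,
`E exp (-∑ₙ Pₙ w(Xₙ)) = exp (∫ λ (L(w(x)) - 1) dx)`, `L` being the Laplace transform of `ν`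
(`IsMarkedPoisson.integral_exp_neg_markedSum`). For simple `w` this follows from conditioning on
the points and the generating function of independent Poisson counts, and in general from `L¹`
approximation. Applied to a complex multiple of the
superposition `h(x) = ∑ⱼ sⱼ ℓ(zⱼ - x)`, it yields
`E exp (-t ∑ⱼ sⱼ Ĩ(zⱼ)) = exp (∫ λ κ(t h(x) / g(λ)) dx)` for the centred field, where
`κ(c) = E[exp (-c p) - 1 + c p]` (`IsMarkedPoisson.integral_exp_neg_scaledShotNoise`).

Integration by parts turns `λ κ(θ / g(λ))` into `∫ θ (1 - exp (-θ u)) λ F̄(g(λ) u) du`. As `g` is an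
asymptotic inverse of `1 / F̄`, the factor `λ F̄(g(λ) u)` tends to `u ^ (-α)`, and Potter bounds
(`exists_potter_bound`) dominate it by powers of `u` with exponents in `(-2, -1)`, so that the
limit is the *stable exponent* `∫ θ (1 - exp (-θ u)) u ^ (-α) du` (`tendsto_mul_centeredLaplace`).
It is homogeneous of degree `α`, and equals `Γ(2 - α) / (α - 1) * θ ^ α` for `θ ≥ 0`.

The value `t = -i` gives the limits of the characteristic functions, `t = 1` those of the Laplace
transforms. Lévy's continuity theorem makes the former the characteristic functions of laws on the
spaces `ℝᴶ`, which are projective, and Kolmogorov's extension theorem (`exists_isProjectiveLimit`)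
assembles them to a field; homogeneity of the exponent makes it stable
(`isStableField_of_forall_integral_exp`). The Laplace transforms pass to the limit because
`exp (-∑ⱼ sⱼ Ĩ(zⱼ))` has bounded second moments, these being Laplace transforms at `2 s`
(`integral_exp_neg_of_tendstoInDistribution`). The regular variation of `g` follows by comparing
values of the monotone tail (`isRegularlyVarying_asymptoticInverse`).
-/

set_option linter.unusedSectionVars false

/-! ### The Kolmogorov extension theorem -/

/-- A decreasing sequence of nonempty intersections of cylinders over compact bases has a common
point: beyond the finitely many coordinates that matter at stage `n`, every point can be moved into
a fixed compact product. -/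
lemma nonempty_iInter_cylinder_of_isCompact {ι : Type*} (J : ℕ → Finset ι)
    (K : ∀ n, Set (J n → ℝ)) (hK : ∀ n, IsCompact (K n))
    (hne : ∀ n, (⋂ k ≤ n, cylinder (α := fun _ : ι ↦ ℝ) (J k) (K k)).Nonempty) :
    (⋂ n, cylinder (α := fun _ : ι ↦ ℝ) (J n) (K n)).Nonempty := by
  classical
  have hKne : ∀ n, (K n).Nonempty := fun n ↦ by
    obtain ⟨y, hy⟩ := hne n
    simp only [Set.mem_iInter] at hy
    exact ⟨_, hy n le_rfl⟩
  -- the compact box: a coordinate is confined by the first base in which it occurs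
  let D : ι → Set ℝ := fun i ↦ if h : ∃ n, i ∈ J n then
    (fun y : J (Nat.find h) → ℝ ↦ y ⟨i, Nat.find_spec h⟩) '' K (Nat.find h) else {0}
  have hDc : ∀ i, IsCompact (D i) := fun i ↦ by
    by_cases h : ∃ n, i ∈ J n
    · simp only [D, dif_pos h]
      exact (hK _).image (continuous_apply _)
    · simp only [D, dif_neg h]
      exact isCompact_singleton
  have hDne : ∀ i, (D i).Nonempty := fun i ↦ by
    by_cases h : ∃ n, i ∈ J n
    · simp only [D, dif_pos h]
      exact (hKne _).image _
    · simp only [D, dif_neg h]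
      exact Set.singleton_nonempty _
  choose a ha using hDne
  have hcl : ∀ n, IsClosed (cylinder (α := fun _ : ι ↦ ℝ) (J n) (K n)) := fun n ↦
    (hK n).isClosed.preimage (by fun_prop)
  have hcl' : ∀ n, IsClosed (⋂ k ≤ n, cylinder (α := fun _ : ι ↦ ℝ) (J k) (K k)) := fun n ↦
    isClosed_iInter fun k ↦ isClosed_iInter fun _ ↦ hcl k
  have hDpc : IsCompact (Set.univ.pi D) := isCompact_univ_pi hDc
  obtain ⟨y, hy⟩ := IsCompact.nonempty_iInter_of_sequence_nonempty_isCompact_isClosed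
    (fun n ↦ (⋂ k ≤ n, cylinder (α := fun _ : ι ↦ ℝ) (J k) (K k)) ∩ Set.univ.pi D)
    (fun n ↦ Set.inter_subset_inter_left _
      (Set.biInter_subset_biInter_left fun k (hk : k ≤ n) ↦ hk.trans n.le_succ))
    (fun n ↦ by
      obtain ⟨y, hy⟩ := hne n
      simp only [Set.mem_iInter] at hy
      refine ⟨fun i ↦ if ∃ k ≤ n, i ∈ J k then y i else a i, ?_, ?_⟩
      · simp only [Set.mem_iInter]
        intro k hk
        have : (J k).restrict (fun i ↦ if ∃ k ≤ n, i ∈ J k then y i else a i)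
            = (J k).restrict y := by
          ext i
          simp only [Finset.restrict]
          rw [if_pos ⟨k, hk, i.2⟩]
        rw [mem_cylinder, this]
        exact hy k hk
      · intro i _
        dsimp only
        split_ifs with h
        · obtain ⟨k, hk, hik⟩ := h
          have h' : ∃ n, i ∈ J n := ⟨k, hik⟩
          simp only [D, dif_pos h']
          exact ⟨_, hy (Nat.find h') ((Nat.find_min' h' hik).trans hk), rfl⟩
        · exact ha i)
    (hDpc.inter_left (hcl' 0))
    (fun n ↦ (hcl' n).inter hDpc.isClosed)
  refine ⟨y, ?_⟩
  simp only [Set.mem_iInter] at hy ⊢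
  intro n
  have := (hy n).1
  simp only [Set.mem_iInter] at this
  exact this n le_rfl

/-- Continuity at the empty set of the content of a projective family: each base is approximated
from inside by a compact set, with total loss smaller than a positive infimum of the contents. -/
lemma projectiveFamilyContent_tendsto_zero {ι : Type*}
    {P : ∀ J : Finset ι, Measure (J → ℝ)} [∀ J, IsProbabilityMeasure (P J)]
    (hP : IsProjectiveMeasureFamily (α := fun _ : ι ↦ ℝ) P) {A : ℕ → Set (ι → ℝ)}
    (hA : ∀ n, A n ∈ measurableCylinders fun _ : ι ↦ ℝ) (hanti : Antitone A)
    (hinter : ⋂ n, A n = ∅) :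
    Tendsto (fun n ↦ projectiveFamilyContent hP (A n)) atTop (𝓝 0) := by
  set m := projectiveFamilyContent hP with hm
  have hmono : Antitone fun n ↦ m (A n) := fun a b hab ↦
    projectiveFamilyContent_mono hP (hA b) (hA a) (hanti hab)
  suffices h : ⨅ n, m (A n) = 0 by
    rw [← h]
    exact tendsto_atTop_iInf hmono
  by_contra hne
  obtain ⟨ε, hε0, hε⟩ := ENNReal.exists_pos_sum_of_countable hne ℕ
  have hA' := fun n ↦ (mem_measurableCylinders (A n)).1 (hA n)
  choose J S hS hAS using hA'
  have hreg : ∀ n, ∃ K ⊆ S n, IsCompact K ∧ P (J n) (S n \ K) ≤ ε n := fun n ↦ by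
    obtain ⟨K, hKS, hK, hlt⟩ := (hS n).exists_isCompact_sdiff_lt (μ := P (J n))
      (measure_ne_top _ _) (ε := ε n) (by simpa using (hε0 n).ne')
    exact ⟨K, hKS, hK, hlt.le⟩
  choose K hKS hK hKε using hreg
  have hC : ∀ n, cylinder (α := fun _ : ι ↦ ℝ) (J n) (K n) ∈
      measurableCylinders fun _ : ι ↦ ℝ := fun n ↦
    cylinder_mem_measurableCylinders _ _ (hK n).measurableSet
  have hCA : ∀ n, cylinder (α := fun _ : ι ↦ ℝ) (J n) (K n) ⊆ A n := fun n ↦ by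
    rw [hAS n]
    exact fun y hy ↦ hKS n hy
  have hdiff : ∀ n, m (A n \ cylinder (α := fun _ : ι ↦ ℝ) (J n) (K n)) ≤ ε n := fun n ↦ by
    rw [hm, projectiveFamilyContent_congr hP (I := J n) (S := S n \ K n) _ _
      ((hS n).diff (hK n).measurableSet)]
    · exact hKε n
    · conv_lhs => rw [hAS n]
      rfl
  have key : (⋂ n, cylinder (α := fun _ : ι ↦ ℝ) (J n) (K n)).Nonempty := by
    refine nonempty_iInter_cylinder_of_isCompact J K hK fun n ↦ ?_
    by_contra hemp
    rw [Set.not_nonempty_iff_eq_empty] at hemp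
    have hsub : A n ⊆ ⋃ k ≤ n, A k \ cylinder (α := fun _ : ι ↦ ℝ) (J k) (K k) := by
      intro y hy
      have : y ∉ ⋂ k ≤ n, cylinder (α := fun _ : ι ↦ ℝ) (J k) (K k) := by simp [hemp]
      simp only [Set.mem_iInter, not_forall] at this
      obtain ⟨k, hk, hyk⟩ := this
      simp only [Set.mem_iUnion]
      exact ⟨k, hk, hanti hk hy, hyk⟩
    have hD : ∀ k, A k \ cylinder (α := fun _ : ι ↦ ℝ) (J k) (K k) ∈
        measurableCylinders fun _ : ι ↦ ℝ := fun k ↦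
      isSetRing_measurableCylinders.sdiff_mem (hA k) (hC k)
    have hU : (⋃ k ≤ n, A k \ cylinder (α := fun _ : ι ↦ ℝ) (J k) (K k))
        ∈ measurableCylinders fun _ : ι ↦ ℝ := by
      have := isSetRing_measurableCylinders.accumulate_mem hD n
      exact this
    have h1 : m (A n) ≤ ∑ i ∈ Finset.range (n + 1), (ε i : ENNReal) :=
      (projectiveFamilyContent_mono hP (hA n) hU hsub).trans
        ((projectiveFamilyContent_iUnion_le hP hD n).trans
          (Finset.sum_le_sum fun i _ ↦ hdiff i))
    have h2 : m (A n) < ⨅ n, m (A n) := (h1.trans (ENNReal.sum_le_tsum _)).trans_lt hε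
    exact absurd (iInf_le (fun n ↦ m (A n)) n) (not_le.2 h2)
  obtain ⟨y, hy⟩ := key
  have : y ∈ ⋂ n, A n := by
    simp only [Set.mem_iInter] at hy ⊢
    exact fun n ↦ hCA n (hy n)
  simp [hinter] at this

/-- **Kolmogorov extension theorem** for real-valued random fields: a projective family of
probability measures has a projective limit. -/
theorem exists_isProjectiveLimit {ι : Type*} (P : ∀ J : Finset ι, Measure (J → ℝ))
    [∀ J, IsProbabilityMeasure (P J)] (hP : IsProjectiveMeasureFamily (α := fun _ : ι ↦ ℝ) P) :
    ∃ Q : Measure (ι → ℝ), IsProbabilityMeasure Q ∧ IsProjectiveLimit (α := fun _ : ι ↦ ℝ) Q P := by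
  have hsub : (projectiveFamilyContent hP).IsSigmaSubadditive :=
    isSigmaSubadditive_of_addContent_iUnion_eq_tsum isSetRing_measurableCylinders
      fun f hf hU hd ↦ addContent_iUnion_eq_sum_of_tendsto_zero isSetRing_measurableCylinders
        (projectiveFamilyContent hP) (fun s hs ↦ projectiveFamilyContent_ne_top _)
        (fun _ h1 h2 h3 ↦ projectiveFamilyContent_tendsto_zero hP h1 h2 h3) hf hU hd
  have hlim : IsProjectiveLimit ((projectiveFamilyContent hP).measure
      isSetSemiring_measurableCylinders generateFrom_measurableCylinders.ge hsub) P := by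
    intro I
    ext s hs
    rw [Measure.map_apply (by fun_prop) hs, AddContent.measure_eq, ← cylinder,
      projectiveFamilyContent_cylinder hP hs]
    · exact generateFrom_measurableCylinders.symm
    · exact cylinder_mem_measurableCylinders _ _ hs
  exact ⟨_, hlim.isProbabilityMeasure, hlim⟩

/-! ### Poisson point processes: Campbell's formula and generating functions -/

lemma lintegral_natCast_poissonMeasure (r : NNReal) :
    ∫⁻ n : ℕ, (n : ENNReal) ∂(poissonMeasure r) = r := by
  rw [lintegral_countable', tsum_eq_zero_add' ENNReal.summable]
  have h : ∀ n : ℕ, ((n + 1 : ℕ) : ENNReal) * poissonMeasure r {n + 1}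
      = r * poissonMeasure r {n} := fun n ↦ by
    rw [poissonMeasure_singleton, poissonMeasure_singleton, ← ENNReal.ofReal_natCast,
      ← ENNReal.ofReal_coe_nnreal, ← ENNReal.ofReal_mul (by positivity),
      ← ENNReal.ofReal_mul (by positivity)]
    congr 1
    rw [Nat.factorial_succ]
    push_cast
    field_simp
    ring
  simp_rw [h]
  rw [ENNReal.tsum_mul_left]
  have : ∑' n, poissonMeasure r {n} = 1 := by
    rw [← measure_univ (μ := poissonMeasure r), ← lintegral_one, lintegral_countable']
    simp
  simp [this]

lemma integral_pow_poissonMeasure (r : NNReal) (z : ℂ) :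
    ∫ n : ℕ, z ^ n ∂(poissonMeasure r) = Complex.exp (r * (z - 1)) := by
  rw [integral_poissonMeasure]
  have h : Complex.exp (r * (z - 1)) = Complex.exp (-r) * Complex.exp (r * z) := by
    rw [← Complex.exp_add]
    ring_nf
  have he : Complex.exp (r * z) = ∑' n : ℕ, (r * z) ^ n / n.factorial := by
    rw [Complex.exp_eq_exp_ℂ, NormedSpace.exp_eq_tsum_div]
  rw [h, he, ← tsum_mul_left]
  congr 1
  ext n
  rw [Complex.real_smul]
  push_cast
  rw [mul_pow]
  ring

section PointProcess

variable {Ω : Type*}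

lemma lintegral_pointMeasure {E : Type*} [MeasurableSpace E] (X : ℕ → Ω → E) (ω : Ω)
    {f : E → ENNReal} (hf : Measurable f) :
    ∫⁻ x, f x ∂(pointMeasure X ω) = ∑' n, f (X n ω) := by
  rw [pointMeasure, lintegral_sum_measure]
  simp [lintegral_dirac' _ hf]

lemma pointMeasure_apply {E : Type*} [MeasurableSpace E] (X : ℕ → Ω → E) (ω : Ω)
    {B : Set E} (hB : MeasurableSet B) :
    pointMeasure X ω B = ∑' n, B.indicator 1 (X n ω) := by
  rw [← lintegral_indicator_one hB,
    lintegral_pointMeasure X ω (measurable_one.indicator hB)]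

/-- The number of points in a set, as a natural number (zero if there are infinitely many). -/
noncomputable def pointCount {E : Type*} [MeasurableSpace E] (X : ℕ → Ω → E) (B : Set E) (ω : Ω) :
    ℕ :=
  ⌊(pointMeasure X ω B).toReal⌋₊

lemma pointCount_eq_card {E : Type*} [MeasurableSpace E] (X : ℕ → Ω → E) (ω : Ω) {B : Set E}
    (hB : MeasurableSet B) (hfin : {n | X n ω ∈ B}.Finite) :
    pointCount X B ω = hfin.toFinset.card := by
  classical
  have h : pointMeasure X ω B = (hfin.toFinset.card : ENNReal) := by
    rw [pointMeasure_apply X _ hB, tsum_eq_sum (s := hfin.toFinset) fun n hn ↦ ?_]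
    · rw [Finset.sum_congr rfl fun n hn ↦ Set.indicator_of_mem (by simpa using hn) _]
      simp
    · exact Set.indicator_of_notMem (by simpa using hn) _
  rw [pointCount, h]
  simp

variable [MeasurableSpace Ω]

lemma measurable_pointMeasure_apply {E : Type*} [MeasurableSpace E] {X : ℕ → Ω → E}
    (hX : ∀ n, Measurable (X n)) {B : Set E} (hB : MeasurableSet B) :
    Measurable fun ω ↦ pointMeasure X ω B := by
  simp_rw [pointMeasure_apply X _ hB]
  exact Measurable.tsum fun n ↦ (measurable_one.indicator hB).comp (hX n)

variable {d : ℕ} {X : ℕ → Ω → EuclideanSpace ℝ (Fin d)} {lam : ℝ} {μ : Measure Ω}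
  [IsProbabilityMeasure μ]

lemma IsHomogeneousPoisson.map_pointMeasure_apply (hX : IsHomogeneousPoisson X lam μ)
    {B : Set (EuclideanSpace ℝ (Fin d))} (hB : MeasurableSet B) (hBv : volume B < ⊤) :
    μ.map (fun ω ↦ pointMeasure X ω B)
      = (poissonMeasure (Real.toNNReal (lam * volume.real B))).map ((↑) : ℕ → ENNReal) := by
  have hm := measurable_pointMeasure_apply hX.measurable hB
  have : IsProbabilityMeasure (μ.map fun ω ↦ pointMeasure X ω B) :=
    Measure.isProbabilityMeasure_map hm.aemeasurable
  symm
  refine Measure.eq_of_le_of_isProbabilityMeasure (Measure.le_iff.2 fun S hS ↦ ?_)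
  rw [Measure.map_apply .of_discrete hS, Measure.map_apply hm hS]
  have h1 : ((↑) : ℕ → ENNReal) ⁻¹' S = ⋃ k ∈ ((↑) : ℕ → ENNReal) ⁻¹' S, {k} := by
    ext k
    simp
  rw [h1, measure_biUnion (Set.to_countable _) (fun i _ j _ hij ↦ by simpa using hij)
    (fun _ _ ↦ .of_discrete)]
  simp_rw [← hX.poisson B hB hBv]
  rw [← measure_biUnion (f := fun k : ℕ ↦ {ω | pointMeasure X ω B = (k : ENNReal)})
    (Set.to_countable _)]
  · refine measure_mono fun ω hω ↦ ?_
    simp only [Set.mem_iUnion, Set.mem_preimage, Set.mem_ofPred_eq] at hω ⊢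
    obtain ⟨k, hk, hk'⟩ := hω
    rwa [hk']
  · intro i _ j _ hij
    rw [Function.onFun, Set.disjoint_left]
    intro ω hi hj
    simp only [Set.mem_ofPred_eq] at hi hj
    exact hij (by exact_mod_cast hi.symm.trans hj)
  · intro i _
    exact hm (measurableSet_singleton _)

lemma IsHomogeneousPoisson.lintegral_pointMeasure_apply (hX : IsHomogeneousPoisson X lam μ)
    (hlam : 0 ≤ lam) {B : Set (EuclideanSpace ℝ (Fin d))} (hB : MeasurableSet B)
    (hBv : volume B < ⊤) :
    ∫⁻ ω, pointMeasure X ω B ∂μ = ENNReal.ofReal lam * volume B := by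
  have hm := measurable_pointMeasure_apply hX.measurable hB
  rw [← lintegral_map (f := fun x : ENNReal ↦ x) measurable_id hm,
    hX.map_pointMeasure_apply hB hBv,
    lintegral_map (f := fun x : ENNReal ↦ x) measurable_id .of_discrete,
    lintegral_natCast_poissonMeasure, ← ENNReal.ofReal, ENNReal.ofReal_mul hlam,
    ofReal_measureReal hBv.ne]

/-- **Campbell's formula**, as an identity of measures. -/
lemma IsHomogeneousPoisson.sum_map (hX : IsHomogeneousPoisson X lam μ) (hlam : 0 ≤ lam) :
    Measure.sum (fun n ↦ μ.map (X n)) = ENNReal.ofReal lam • volume := by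
  refine Measure.ext_of_iUnion_eq_univ (iUnion_spanningSets volume) fun i ↦ ?_
  ext B hB
  have hBi : MeasurableSet (B ∩ spanningSets volume i) :=
    hB.inter (measurableSet_spanningSets _ _)
  have hv : volume (B ∩ spanningSets (volume : Measure (EuclideanSpace ℝ (Fin d))) i) < ⊤ :=
    (measure_mono Set.inter_subset_right).trans_lt (measure_spanningSets_lt_top _ _)
  rw [Measure.restrict_apply hB, Measure.restrict_apply hB, Measure.sum_apply _ hBi,
    Measure.smul_apply, smul_eq_mul, ← hX.lintegral_pointMeasure_apply hlam hBi hv]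
  simp_rw [pointMeasure_apply X _ hBi]
  rw [lintegral_tsum (f := fun n ω ↦ (B ∩ spanningSets volume i).indicator 1 (X n ω)) fun n ↦
    ((measurable_one.indicator hBi).comp (hX.measurable n)).aemeasurable]
  congr 1
  ext n
  rw [← lintegral_indicator_one hBi, lintegral_map (measurable_one.indicator hBi) (hX.measurable n)]

/-- **Campbell's formula** for the mean of a sum over the points. -/
lemma IsHomogeneousPoisson.tsum_lintegral (hX : IsHomogeneousPoisson X lam μ) (hlam : 0 ≤ lam)
    {f : EuclideanSpace ℝ (Fin d) → ENNReal} (hf : Measurable f) :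
    ∑' n, ∫⁻ ω, f (X n ω) ∂μ = ENNReal.ofReal lam * ∫⁻ x, f x := by
  have h := congrArg (fun M ↦ ∫⁻ x, f x ∂M) (hX.sum_map hlam)
  simp only [lintegral_sum_measure, lintegral_smul_measure, smul_eq_mul] at h
  rw [← h]
  congr 1
  ext n
  rw [lintegral_map hf (hX.measurable n)]

lemma IsHomogeneousPoisson.integral_pow_pointCount (hX : IsHomogeneousPoisson X lam μ)
    (hlam : 0 ≤ lam) {B : Set (EuclideanSpace ℝ (Fin d))} (hB : MeasurableSet B)
    (hBv : volume B < ⊤) (z : ℂ) :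
    ∫ ω, z ^ pointCount X B ω ∂μ = Complex.exp (lam * volume.real B * (z - 1)) := by
  have hm := measurable_pointMeasure_apply hX.measurable hB
  have hz : Measurable fun x : ENNReal ↦ z ^ ⌊x.toReal⌋₊ :=
    (Measurable.of_discrete (f := fun n : ℕ ↦ z ^ n)).comp
      (Nat.measurable_floor.comp ENNReal.measurable_toReal)
  have h := integral_map (μ := μ) hm.aemeasurable hz.aestronglyMeasurable
  unfold pointCount
  rw [← h, hX.map_pointMeasure_apply hB hBv, integral_map .of_discrete hz.aestronglyMeasurable]
  simp only [ENNReal.toReal_natCast, Nat.floor_natCast]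
  rw [integral_pow_poissonMeasure, Real.coe_toNNReal _ (by positivity)]
  push_cast
  rfl

/-- The joint generating function of the numbers of points in disjoint sets. -/
lemma IsHomogeneousPoisson.integral_prod_pow_pointCount (hX : IsHomogeneousPoisson X lam μ)
    (hlam : 0 ≤ lam) {m : ℕ} {B : Fin m → Set (EuclideanSpace ℝ (Fin d))}
    (hB : ∀ i, MeasurableSet (B i)) (hBv : ∀ i, volume (B i) < ⊤)
    (hd : Pairwise fun i j ↦ Disjoint (B i) (B j)) (z : Fin m → ℂ) :
    ∫ ω, ∏ i, z i ^ pointCount X (B i) ω ∂μ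
      = Complex.exp (lam * ∑ i, volume.real (B i) * (z i - 1)) := by
  have hz : ∀ i, Measurable fun x : ENNReal ↦ z i ^ ⌊x.toReal⌋₊ := fun i ↦
    (Measurable.of_discrete (f := fun n : ℕ ↦ z i ^ n)).comp
      (Nat.measurable_floor.comp ENNReal.measurable_toReal)
  have h := (hX.indep m B hB hBv hd).integral_fun_prod_comp
    (fun i ↦ (measurable_pointMeasure_apply hX.measurable (hB i)).aemeasurable)
    (f := fun i x ↦ z i ^ ⌊x.toReal⌋₊) (fun i ↦ (hz i).aestronglyMeasurable)
  unfold pointCount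
  rw [h, Finset.mul_sum, Complex.exp_sum]
  refine Finset.prod_congr rfl fun i _ ↦ ?_
  rw [← mul_assoc]
  exact hX.integral_pow_pointCount hlam (hB i) (hBv i) (z i)

lemma IsHomogeneousPoisson.ae_finite (hX : IsHomogeneousPoisson X lam μ) (hlam : 0 ≤ lam)
    {B : Set (EuclideanSpace ℝ (Fin d))} (hB : MeasurableSet B) (hBv : volume B < ⊤) :
    ∀ᵐ ω ∂μ, {n | X n ω ∈ B}.Finite := by
  have hm := measurable_pointMeasure_apply hX.measurable hB
  have h : ∫⁻ ω, pointMeasure X ω B ∂μ ≠ ⊤ := by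
    rw [hX.lintegral_pointMeasure_apply hlam hB hBv]
    exact ENNReal.mul_ne_top ENNReal.ofReal_ne_top hBv.ne
  filter_upwards [ae_lt_top hm h] with ω hω
  rw [pointMeasure_apply X _ hB] at hω
  have := ENNReal.finite_const_le_of_tsum_ne_top hω.ne one_ne_zero
  refine this.subset fun n hn ↦ ?_
  have hn' : X n ω ∈ B := hn
  simp [Set.indicator_of_mem hn']

end PointProcess

/-! ### The Laplace functional of a marked Poisson process -/

lemma norm_exp_neg_le_one {c : ℂ} (hc : 0 ≤ c.re) : ‖Complex.exp (-c)‖ ≤ 1 := by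
  rw [Complex.norm_exp, Complex.neg_re]
  exact Real.exp_le_one_iff.2 (by linarith)

lemma norm_exp_neg_sub_exp_neg_le {a b : ℂ} (ha : 0 ≤ a.re) (hb : 0 ≤ b.re) :
    ‖Complex.exp (-a) - Complex.exp (-b)‖ ≤ ‖a - b‖ := by
  have h := (convex_halfSpace_re_ge 0).norm_image_sub_le_of_norm_hasDerivWithin_le
    (f := fun c : ℂ ↦ Complex.exp (-c)) (f' := fun c ↦ -Complex.exp (-c)) (C := 1) (x := b) (y := a)
    (fun c _ ↦ by simpa using ((hasDerivAt_neg c).cexp).hasDerivWithinAt)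
    (fun c hc ↦ by simpa using norm_exp_neg_le_one hc) hb ha
  simpa using h

/-- The Laplace transform of a law `ν` on the real line at a complex argument. -/
noncomputable def complexLaplace (ν : Measure ℝ) (c : ℂ) : ℂ :=
  ∫ p : ℝ, Complex.exp (-((p : ℂ) * c)) ∂ν

lemma measurable_complexLaplace (ν : Measure ℝ) [SFinite ν] : Measurable (complexLaplace ν) := by
  have h : StronglyMeasurable fun q : ℂ × ℝ ↦ Complex.exp (-((q.2 : ℂ) * q.1)) :=
    (by fun_prop : Measurable _).stronglyMeasurable
  exact h.integral_prod_right.measurable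

section Law

variable {ν : Measure ℝ} [IsProbabilityMeasure ν]

lemma ae_nonneg_of_measure_Iio (hν : ν (Set.Iio 0) = 0) : ∀ᵐ p ∂ν, 0 ≤ p := by
  rw [ae_iff]
  simpa [Set.Iio] using hν

lemma re_ofReal_mul_nonneg {p : ℝ} {c : ℂ} (hp : 0 ≤ p) (hc : 0 ≤ c.re) : 0 ≤ ((p : ℂ) * c).re := by
  rw [Complex.re_ofReal_mul]
  positivity

lemma integrable_exp_neg_mul (hν : ν (Set.Iio 0) = 0) {c : ℂ} (hc : 0 ≤ c.re) :
    Integrable (fun p : ℝ ↦ Complex.exp (-((p : ℂ) * c))) ν := by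
  refine (integrable_const (1 : ℝ)).mono' (by fun_prop) ?_
  filter_upwards [ae_nonneg_of_measure_Iio hν] with p hp
  exact norm_exp_neg_le_one (re_ofReal_mul_nonneg hp hc)

lemma complexLaplace_zero : complexLaplace ν 0 = 1 := by simp [complexLaplace]

lemma norm_complexLaplace_le_one (hν : ν (Set.Iio 0) = 0) {c : ℂ} (hc : 0 ≤ c.re) :
    ‖complexLaplace ν c‖ ≤ 1 := by
  have h := norm_integral_le_of_norm_le_const (μ := ν) (C := 1)
    (f := fun p : ℝ ↦ Complex.exp (-((p : ℂ) * c))) (by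
      filter_upwards [ae_nonneg_of_measure_Iio hν] with p hp
      exact norm_exp_neg_le_one (re_ofReal_mul_nonneg hp hc))
  simpa [complexLaplace] using h

lemma norm_complexLaplace_sub_le (hν : ν (Set.Iio 0) = 0) (hm : Integrable (fun p : ℝ ↦ p) ν)
    {a b : ℂ} (ha : 0 ≤ a.re) (hb : 0 ≤ b.re) :
    ‖complexLaplace ν a - complexLaplace ν b‖ ≤ (∫ p, p ∂ν) * ‖a - b‖ := by
  rw [complexLaplace, complexLaplace,
    ← integral_sub (integrable_exp_neg_mul hν ha) (integrable_exp_neg_mul hν hb),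
    ← integral_mul_const]
  refine norm_integral_le_of_norm_le (hm.mul_const _) ?_
  filter_upwards [ae_nonneg_of_measure_Iio hν] with p hp
  refine (norm_exp_neg_sub_exp_neg_le (re_ofReal_mul_nonneg hp ha)
    (re_ofReal_mul_nonneg hp hb)).trans_eq ?_
  rw [← mul_sub, norm_mul, Complex.norm_real, Real.norm_of_nonneg hp]

end Law

/-- The points `Xₙ` of a homogeneous Poisson process of intensity `lam` carry independent marks
`Pₙ` with common law `ν`, and the marks are independent of the points. -/
structure IsMarkedPoisson {Ω : Type*} [MeasurableSpace Ω] {d : ℕ}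
    (X : ℕ → Ω → EuclideanSpace ℝ (Fin d)) (P : ℕ → Ω → ℝ) (lam : ℝ) (ν : Measure ℝ)
    (μ : Measure Ω) : Prop where
  poisson : IsHomogeneousPoisson X lam μ
  pos : 0 < lam
  law : ∀ n, HasLaw (P n) ν μ
  iIndep : iIndepFun P μ
  indep : IndepFun (fun ω n ↦ P n ω) (fun ω n ↦ X n ω) μ

/-- The sum of `p * w x` over the points `x` with their marks `p`. -/
noncomputable def markedSum {Ω E : Type*} (w : E → ℂ) (P : ℕ → Ω → ℝ) (X : ℕ → Ω → E) (ω : Ω) :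
    ℂ :=
  ∑' n, (P n ω : ℂ) * w (X n ω)

section Marked

variable {Ω : Type*} [MeasurableSpace Ω] {d : ℕ} {X : ℕ → Ω → EuclideanSpace ℝ (Fin d)}
  {P : ℕ → Ω → ℝ} {lam : ℝ} {ν : Measure ℝ} [IsProbabilityMeasure ν] {μ : Measure Ω}
  [IsProbabilityMeasure μ] {w w' : EuclideanSpace ℝ (Fin d) → ℂ}

lemma IsMarkedPoisson.ae_nonneg (h : IsMarkedPoisson X P lam ν μ) (hν : ν (Set.Iio 0) = 0) :
    ∀ᵐ ω ∂μ, ∀ n, 0 ≤ P n ω := by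
  rw [ae_all_iff]
  intro n
  have := ae_nonneg_of_measure_Iio hν
  rw [← (h.law n).map_eq] at this
  exact ae_of_ae_map (h.law n).aemeasurable this

lemma IsMarkedPoisson.indepFun_apply (h : IsMarkedPoisson X P lam ν μ) (n : ℕ) :
    IndepFun (P n) (X n) μ :=
  h.indep.comp (φ := fun p : ℕ → ℝ ↦ p n) (ψ := fun x : ℕ → EuclideanSpace ℝ (Fin d) ↦ x n)
    (measurable_pi_apply n) (measurable_pi_apply n)

lemma IsMarkedPoisson.aemeasurable_mul (h : IsMarkedPoisson X P lam ν μ) (hw : Measurable w)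
    (n : ℕ) : AEMeasurable (fun ω ↦ (P n ω : ℂ) * w (X n ω)) μ :=
  (Complex.measurable_ofReal.comp_aemeasurable (h.law n).aemeasurable).mul
    (hw.comp (h.poisson.measurable n)).aemeasurable

lemma IsMarkedPoisson.tsum_lintegral_enorm (h : IsMarkedPoisson X P lam ν μ) (hw : Measurable w) :
    ∑' n, ∫⁻ ω, ‖(P n ω : ℂ) * w (X n ω)‖ₑ ∂μ
      = (∫⁻ p, ‖p‖ₑ ∂ν) * (ENNReal.ofReal lam * ∫⁻ x, ‖w x‖ₑ) := by
  rw [← h.poisson.tsum_lintegral h.pos.le (f := fun x ↦ ‖w x‖ₑ) hw.enorm, ← ENNReal.tsum_mul_left]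
  congr 1
  ext n
  have h1 := lintegral_mul_eq_lintegral_mul_lintegral_of_indepFun'' (μ := μ)
    (f := fun ω ↦ ‖P n ω‖ₑ) (g := fun ω ↦ ‖w (X n ω)‖ₑ) (h.law n).aemeasurable.enorm
    (hw.comp (h.poisson.measurable n)).enorm.aemeasurable
    ((h.indepFun_apply n).comp measurable_enorm hw.enorm)
  have h2 : ∫⁻ ω, ‖P n ω‖ₑ ∂μ = ∫⁻ p, ‖p‖ₑ ∂ν := by
    rw [← (h.law n).map_eq, lintegral_map' (by fun_prop) (h.law n).aemeasurable]
  rw [← h2, ← h1]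
  congr 1
  ext ω
  rw [enorm_mul]
  congr 1
  rw [← ofReal_norm, ← ofReal_norm, Complex.norm_real]

lemma IsMarkedPoisson.tsum_lintegral_enorm_ne_top (h : IsMarkedPoisson X P lam ν μ)
    (hm : Integrable (fun p : ℝ ↦ p) ν) (hw : Measurable w) (hwi : Integrable w) :
    ∑' n, ∫⁻ ω, ‖(P n ω : ℂ) * w (X n ω)‖ₑ ∂μ ≠ ⊤ := by
  rw [h.tsum_lintegral_enorm hw]
  exact ENNReal.mul_ne_top hm.2.ne (ENNReal.mul_ne_top ENNReal.ofReal_ne_top hwi.2.ne)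

lemma IsMarkedPoisson.ae_summable (h : IsMarkedPoisson X P lam ν μ)
    (hm : Integrable (fun p : ℝ ↦ p) ν) (hw : Measurable w) (hwi : Integrable w) :
    ∀ᵐ ω ∂μ, Summable fun n ↦ (P n ω : ℂ) * w (X n ω) := by
  have hs := h.tsum_lintegral_enorm_ne_top hm hw hwi
  rw [← lintegral_tsum fun n ↦ (h.aemeasurable_mul hw n).enorm] at hs
  filter_upwards [ae_lt_top' (AEMeasurable.tsum fun n ↦ (h.aemeasurable_mul hw n).enorm) hs]
    with ω hω
  refine Summable.of_norm ?_
  have := ENNReal.summable_toReal hω.ne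
  simpa using this

lemma IsMarkedPoisson.aestronglyMeasurable_markedSum (h : IsMarkedPoisson X P lam ν μ)
    (hm : Integrable (fun p : ℝ ↦ p) ν) (hw : Measurable w) (hwi : Integrable w) :
    AEStronglyMeasurable (markedSum w P X) μ := by
  refine aestronglyMeasurable_of_tendsto_ae atTop
    (f := fun K ω ↦ ∑ n ∈ Finset.range K, (P n ω : ℂ) * w (X n ω))
    (fun K ↦ Finset.aestronglyMeasurable_fun_sum _ fun n _ ↦
      (h.aemeasurable_mul hw n).aestronglyMeasurable) ?_
  filter_upwards [h.ae_summable hm hw hwi] with ω hω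
  exact hω.hasSum.tendsto_sum_nat

lemma IsMarkedPoisson.lintegral_enorm_markedSum_le (h : IsMarkedPoisson X P lam ν μ)
    (hw : Measurable w) :
    ∫⁻ ω, ‖markedSum w P X ω‖ₑ ∂μ
      ≤ (∫⁻ p, ‖p‖ₑ ∂ν) * (ENNReal.ofReal lam * ∫⁻ x, ‖w x‖ₑ) := by
  rw [← h.tsum_lintegral_enorm hw, ← lintegral_tsum fun n ↦ (h.aemeasurable_mul hw n).enorm]
  exact lintegral_mono fun ω ↦ enorm_tsum_le_tsum_enorm

lemma IsMarkedPoisson.integrable_markedSum (h : IsMarkedPoisson X P lam ν μ)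
    (hm : Integrable (fun p : ℝ ↦ p) ν) (hw : Measurable w) (hwi : Integrable w) :
    Integrable (markedSum w P X) μ := by
  refine ⟨h.aestronglyMeasurable_markedSum hm hw hwi, ?_⟩
  refine (h.lintegral_enorm_markedSum_le hw).trans_lt ?_
  rw [← h.tsum_lintegral_enorm hw]
  exact (h.tsum_lintegral_enorm_ne_top hm hw hwi).lt_top

lemma IsMarkedPoisson.integral_markedSum (h : IsMarkedPoisson X P lam ν μ)
    (hm : Integrable (fun p : ℝ ↦ p) ν) (hw : Measurable w) (hwi : Integrable w) :
    ∫ ω, markedSum w P X ω ∂μ = ((∫ p, p ∂ν : ℝ) : ℂ) * (lam * ∫ x, w x) := by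
  unfold markedSum
  rw [integral_tsum (fun n ↦ (h.aemeasurable_mul hw n).aestronglyMeasurable)
    (h.tsum_lintegral_enorm_ne_top hm hw hwi)]
  have h1 : ∀ n, ∫ ω, (P n ω : ℂ) * w (X n ω) ∂μ
      = ((∫ p, p ∂ν : ℝ) : ℂ) * ∫ x, w x ∂(μ.map (X n)) := fun n ↦ by
    have h2 := IndepFun.integral_fun_mul_eq_mul_integral (𝕜 := ℂ)
      ((h.indepFun_apply n).comp Complex.measurable_ofReal hw)
      (Complex.measurable_ofReal.comp_aemeasurable (h.law n).aemeasurable).aestronglyMeasurable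
      (hw.comp (h.poisson.measurable n)).aestronglyMeasurable
    simp only [Function.comp_apply] at h2
    rw [h2, integral_complex_ofReal, integral_map (h.poisson.measurable n).aemeasurable
      hw.aestronglyMeasurable, ← (h.law n).map_eq,
      integral_map (h.law n).aemeasurable (by fun_prop)]
  simp_rw [h1]
  rw [tsum_mul_left]
  have hi : Integrable w (Measure.sum fun n ↦ μ.map (X n)) := by
    rw [h.poisson.sum_map h.pos.le]
    exact hwi.smul_measure ENNReal.ofReal_ne_top
  rw [← integral_sum_measure hi, h.poisson.sum_map h.pos.le, integral_smul_measure,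
    ENNReal.toReal_ofReal h.pos.le]
  simp

lemma IsMarkedPoisson.markedSum_sub (h : IsMarkedPoisson X P lam ν μ)
    (hm : Integrable (fun p : ℝ ↦ p) ν) (hw : Measurable w) (hwi : Integrable w)
    (hw' : Measurable w') (hwi' : Integrable w') :
    ∀ᵐ ω ∂μ, markedSum (fun x ↦ w x - w' x) P X ω = markedSum w P X ω - markedSum w' P X ω := by
  filter_upwards [h.ae_summable hm hw hwi, h.ae_summable hm hw' hwi'] with ω h1 h2
  simp only [markedSum]
  rw [← h1.tsum_sub h2]
  simp_rw [mul_sub]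

lemma IsMarkedPoisson.re_markedSum_nonneg (h : IsMarkedPoisson X P lam ν μ)
    (hν : ν (Set.Iio 0) = 0) (hre : ∀ x, 0 ≤ (w x).re) :
    ∀ᵐ ω ∂μ, 0 ≤ (markedSum w P X ω).re := by
  filter_upwards [h.ae_nonneg hν] with ω hω
  by_cases hs : Summable fun n ↦ (P n ω : ℂ) * w (X n ω)
  · rw [markedSum, Complex.re_tsum hs]
    exact tsum_nonneg fun n ↦ re_ofReal_mul_nonneg (hω n) (hre _)
  · rw [markedSum, tsum_eq_zero_of_not_summable hs]
    simp

/-- Conditioning on the points: each mark contributes its own Laplace transform. -/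
lemma IsMarkedPoisson.integral_exp_neg_sum_range (h : IsMarkedPoisson X P lam ν μ)
    (hν : ν (Set.Iio 0) = 0) (hw : Measurable w) (hre : ∀ x, 0 ≤ (w x).re) (K : ℕ) :
    ∫ ω, Complex.exp (-∑ n ∈ Finset.range K, (P n ω : ℂ) * w (X n ω)) ∂μ
      = ∫ ω, ∏ n ∈ Finset.range K, complexLaplace ν (w (X n ω)) ∂μ := by
  have hPm : AEMeasurable (fun ω n ↦ P n ω) μ :=
    aemeasurable_pi_iff.2 fun n ↦ (h.law n).aemeasurable
  have hXm : Measurable fun ω n ↦ X n ω := measurable_pi_iff.2 h.poisson.measurable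
  let F : (ℕ → ℝ) × (ℕ → EuclideanSpace ℝ (Fin d)) → ℂ :=
    fun q ↦ Complex.exp (-∑ n ∈ Finset.range K, (q.1 n : ℂ) * w (q.2 n))
  have hF : Measurable F := by
    refine Complex.measurable_exp.comp (Finset.measurable_fun_sum _ fun n _ ↦ ?_).neg
    exact (Complex.measurable_ofReal.comp ((measurable_pi_apply n).comp measurable_fst)).mul
      (hw.comp ((measurable_pi_apply n).comp measurable_snd))
  have hmap := (indepFun_iff_map_prod_eq_prod_map_map hPm hXm.aemeasurable).1 h.indep
  have hPX : AEMeasurable (fun ω ↦ ((fun n ↦ P n ω), fun n ↦ X n ω)) μ :=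
    hPm.prodMk hXm.aemeasurable
  have hFi : Integrable F ((μ.map fun ω n ↦ P n ω).prod (μ.map fun ω n ↦ X n ω)) := by
    rw [← hmap, integrable_map_measure hF.aestronglyMeasurable hPX]
    refine (integrable_const (1 : ℝ)).mono' (hF.comp_aemeasurable hPX).aestronglyMeasurable ?_
    filter_upwards [h.ae_nonneg hν] with ω hω
    refine norm_exp_neg_le_one ?_
    rw [Complex.re_sum]
    exact Finset.sum_nonneg fun n _ ↦ re_ofReal_mul_nonneg (hω n) (hre _)
  have hpp : IsProbabilityMeasure (μ.map fun ω n ↦ P n ω) := Measure.isProbabilityMeasure_map hPm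
  have hpx : IsProbabilityMeasure (μ.map fun ω n ↦ X n ω) :=
    Measure.isProbabilityMeasure_map hXm.aemeasurable
  have h1 : ∫ ω, Complex.exp (-∑ n ∈ Finset.range K, (P n ω : ℂ) * w (X n ω)) ∂μ
      = ∫ x, ∫ p, F (p, x) ∂(μ.map fun ω n ↦ P n ω) ∂(μ.map fun ω n ↦ X n ω) := by
    rw [← integral_prod_symm _ hFi, ← hmap, integral_map hPX hF.aestronglyMeasurable]
  have h2 : ∀ x : ℕ → EuclideanSpace ℝ (Fin d), ∫ p, F (p, x) ∂(μ.map fun ω n ↦ P n ω)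
      = ∏ n ∈ Finset.range K, complexLaplace ν (w (x n)) := fun x ↦ by
    rw [integral_map (f := fun p ↦ F (p, x)) hPm
      (hF.comp measurable_prodMk_right).aestronglyMeasurable]
    have hK : iIndepFun (fun n : Fin K ↦ P n) μ := h.iIndep.precomp Fin.val_injective
    have h3 := hK.integral_fun_prod_comp
      (f := fun (n : Fin K) (p : ℝ) ↦ Complex.exp (-((p : ℂ) * w (x n))))
      (fun n ↦ (h.law n).aemeasurable)
      (fun n ↦ (by fun_prop : Measurable _).aestronglyMeasurable)
    rw [Finset.prod_range]
    simp only [F]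
    have h4 : ∀ n : Fin K, complexLaplace ν (w (x n))
        = ∫ ω, Complex.exp (-((P n ω : ℂ) * w (x n))) ∂μ := fun n ↦ by
      rw [complexLaplace, ← (h.law n).map_eq, integral_map (h.law n).aemeasurable (by fun_prop)]
    simp_rw [h4]
    rw [← h3]
    congr 1
    ext ω
    rw [← Complex.exp_sum, Finset.sum_range, Finset.sum_neg_distrib]
  rw [h1]
  simp_rw [h2]
  rw [integral_map hXm.aemeasurable]
  refine (Finset.measurable_fun_prod _ fun n _ ↦ ?_).aestronglyMeasurable
  exact (measurable_complexLaplace ν).comp (hw.comp (measurable_pi_apply n))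

lemma IsHomogeneousPoisson.integral_finset_prod_pow_pointCount
    (hX : IsHomogeneousPoisson X lam μ) (hlam : 0 ≤ lam) {ι : Type*} (s : Finset ι)
    {B : ι → Set (EuclideanSpace ℝ (Fin d))}
    (hB : ∀ i ∈ s, MeasurableSet (B i)) (hBv : ∀ i ∈ s, volume (B i) < ⊤)
    (hd : ∀ i ∈ s, ∀ j ∈ s, i ≠ j → Disjoint (B i) (B j)) (z : ι → ℂ) :
    ∫ ω, ∏ i ∈ s, z i ^ pointCount X (B i) ω ∂μ
      = Complex.exp (lam * ∑ i ∈ s, volume.real (B i) * (z i - 1)) := by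
  let e := s.equivFin.symm
  have h := hX.integral_prod_pow_pointCount hlam (B := fun k ↦ B (e k))
    (fun k ↦ hB _ (e k).2) (fun k ↦ hBv _ (e k).2)
    (fun k l hkl ↦ hd _ (e k).2 _ (e l).2 fun hh ↦ hkl (e.injective (Subtype.ext hh)))
    (fun k ↦ z (e k))
  rw [← Finset.sum_coe_sort s, ← e.sum_comp, ← h]
  congr 1
  ext ω
  rw [← Finset.prod_coe_sort s, ← e.prod_comp]

/-- If a function with finitely many values has only finitely many points in its support, then
products along the sequence of points are eventually products over the values. -/
lemma tendsto_prod_range_simpleFunc (f : SimpleFunc (EuclideanSpace ℝ (Fin d)) ℂ) {u : ℂ → ℂ}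
    (hu : u 0 = 1) {ω : Ω} (hfin : {n | X n ω ∈ Function.support f}.Finite) :
    Tendsto (fun K ↦ ∏ n ∈ Finset.range K, u (f (X n ω))) atTop
      (𝓝 (∏ c ∈ f.range.erase 0, u c ^ pointCount X (f ⁻¹' {c}) ω)) := by
  classical
  have h1 : ∀ᶠ K in atTop, ∏ n ∈ Finset.range K, u (f (X n ω))
      = ∏ n ∈ hfin.toFinset, u (f (X n ω)) := by
    obtain ⟨K₀, hK₀⟩ := hfin.toFinset.exists_nat_subset_range
    filter_upwards [eventually_ge_atTop K₀] with K hK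
    refine (Finset.prod_subset (hK₀.trans (Finset.range_mono hK)) fun n _ hn ↦ ?_).symm
    have : f (X n ω) = 0 := by simpa using hn
    rw [this, hu]
  refine Tendsto.congr' (h1.mono fun K hK ↦ hK.symm) ?_
  have h2 : ∏ n ∈ hfin.toFinset, u (f (X n ω))
      = ∏ c ∈ f.range.erase 0, u c ^ pointCount X (f ⁻¹' {c}) ω := by
    rw [← Finset.prod_fiberwise_of_maps_to (t := f.range.erase 0) (g := fun n ↦ f (X n ω))
      (fun n hn ↦ by simpa using hn)]
    refine Finset.prod_congr rfl fun c hc ↦ ?_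
    have hc0 : c ≠ 0 := (Finset.mem_erase.1 hc).1
    have hsub : {n | X n ω ∈ f ⁻¹' {c}} ⊆ {n | X n ω ∈ Function.support f} := fun n hn ↦ by
      have : f (X n ω) = c := hn
      show f (X n ω) ≠ 0
      rwa [this]
    rw [pointCount_eq_card X ω (f.measurableSet_fiber c) (hfin.subset hsub)]
    rw [Finset.prod_congr rfl (g := fun _ ↦ u c) fun n hn ↦ by rw [(Finset.mem_filter.1 hn).2],
      Finset.prod_const]
    congr 2
    ext n
    simp only [Finset.mem_filter, Set.Finite.mem_toFinset, Set.mem_ofPred_eq, Set.mem_preimage,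
      Set.mem_singleton_iff, Function.mem_support]
    constructor
    · exact fun hn ↦ hn.2
    · exact fun hn ↦ ⟨by rwa [hn], hn⟩
  rw [h2]
  exact tendsto_const_nhds

lemma IsMarkedPoisson.tendsto_integral_exp_neg_sum_range (h : IsMarkedPoisson X P lam ν μ)
    (hν : ν (Set.Iio 0) = 0) (hm : Integrable (fun p : ℝ ↦ p) ν) (hw : Measurable w)
    (hwi : Integrable w) (hre : ∀ x, 0 ≤ (w x).re) :
    Tendsto (fun K ↦ ∫ ω, Complex.exp (-∑ n ∈ Finset.range K, (P n ω : ℂ) * w (X n ω)) ∂μ) atTop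
      (𝓝 (∫ ω, Complex.exp (-markedSum w P X ω) ∂μ)) := by
  refine tendsto_integral_of_dominated_convergence (fun _ ↦ 1) (fun K ↦ ?_) (integrable_const _)
    (fun K ↦ ?_) ?_
  · exact Complex.continuous_exp.comp_aestronglyMeasurable
      (Finset.aestronglyMeasurable_fun_sum _ fun n _ ↦
        (h.aemeasurable_mul hw n).aestronglyMeasurable).neg
  · filter_upwards [h.ae_nonneg hν] with ω hω
    refine norm_exp_neg_le_one ?_
    rw [Complex.re_sum]
    exact Finset.sum_nonneg fun n _ ↦ re_ofReal_mul_nonneg (hω n) (hre _)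
  · filter_upwards [h.ae_summable hm hw hwi] with ω hω
    exact (Complex.continuous_exp.tendsto _).comp hω.hasSum.tendsto_sum_nat.neg

lemma integrable_complexLaplace_sub_one (hν : ν (Set.Iio 0) = 0)
    (hm : Integrable (fun p : ℝ ↦ p) ν) (hw : Measurable w)
    (hwi : Integrable w) (hre : ∀ x, 0 ≤ (w x).re) :
    Integrable fun x ↦ complexLaplace ν (w x) - 1 := by
  refine (hwi.norm.const_mul (∫ p, p ∂ν)).mono'
    (((measurable_complexLaplace ν).comp hw).sub_const 1).aestronglyMeasurable
    (ae_of_all _ fun x ↦ ?_)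
  have := norm_complexLaplace_sub_le hν hm (hre x) (b := 0) le_rfl
  simpa [complexLaplace_zero] using this

lemma IsMarkedPoisson.integral_exp_neg_markedSum_simpleFunc (h : IsMarkedPoisson X P lam ν μ)
    (hν : ν (Set.Iio 0) = 0) (hm : Integrable (fun p : ℝ ↦ p) ν)
    (f : SimpleFunc (EuclideanSpace ℝ (Fin d)) ℂ)
    (hfi : Integrable f) (hre : ∀ x, 0 ≤ (f x).re) :
    ∫ ω, Complex.exp (-markedSum f P X ω) ∂μ
      = Complex.exp (lam * ∫ x, (complexLaplace ν (f x) - 1)) := by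
  have h1 := h.tendsto_integral_exp_neg_sum_range hν hm f.measurable hfi hre
  simp_rw [h.integral_exp_neg_sum_range hν f.measurable hre] at h1
  have hsupp : volume (Function.support f) < ⊤ := f.measure_support_lt_top_of_integrable hfi
  have h2 : Tendsto (fun K ↦ ∫ ω, ∏ n ∈ Finset.range K, complexLaplace ν (f (X n ω)) ∂μ) atTop
      (𝓝 (∫ ω, ∏ c ∈ f.range.erase 0, complexLaplace ν c ^ pointCount X (f ⁻¹' {c}) ω ∂μ)) := by
    refine tendsto_integral_of_dominated_convergence (fun _ ↦ 1) (fun K ↦ ?_) (integrable_const _)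
      (fun K ↦ ?_) ?_
    · refine (Finset.measurable_fun_prod _ fun n _ ↦ ?_).aestronglyMeasurable
      exact (measurable_complexLaplace ν).comp (f.measurable.comp (h.poisson.measurable n))
    · refine ae_of_all _ fun ω ↦ ?_
      rw [norm_prod]
      exact Finset.prod_le_one (fun _ _ ↦ norm_nonneg _)
        fun n _ ↦ norm_complexLaplace_le_one hν (hre _)
    · filter_upwards [h.poisson.ae_finite h.pos.le f.measurableSet_support hsupp] with ω hω
      exact tendsto_prod_range_simpleFunc f complexLaplace_zero hω
  rw [tendsto_nhds_unique h1 h2, h.poisson.integral_finset_prod_pow_pointCount h.pos.le]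
  · have h3 := f.map_integral (fun c ↦ complexLaplace ν c - 1) hfi (by simp [complexLaplace_zero])
    have h4 : ∫ x, (complexLaplace ν (f x) - 1)
        = (f.map fun c ↦ complexLaplace ν c - 1).integral volume :=
      (SimpleFunc.integral_eq_integral (f.map fun c ↦ complexLaplace ν c - 1)
        (integrable_complexLaplace_sub_one hν hm f.measurable hfi hre)).symm
    rw [h4, h3]
    congr 2
    simp_rw [Complex.real_smul]
    exact Finset.sum_erase _ (by simp [complexLaplace_zero])
  · exact fun c _ ↦ f.measurableSet_fiber c
  · intro c hc
    exact f.measure_preimage_lt_top_of_integrable hfi (Finset.mem_erase.1 hc).1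
  · intro i _ j _ hij
    exact Disjoint.preimage _ (by simpa using hij)

/-- The Laplace functional is Lipschitz continuous in `L¹`. -/
lemma IsMarkedPoisson.norm_integral_exp_neg_sub_le (h : IsMarkedPoisson X P lam ν μ)
    (hν : ν (Set.Iio 0) = 0) (hm : Integrable (fun p : ℝ ↦ p) ν) (hw : Measurable w)
    (hwi : Integrable w) (hre : ∀ x, 0 ≤ (w x).re) (hw' : Measurable w')
    (hwi' : Integrable w') (hre' : ∀ x, 0 ≤ (w' x).re) :
    ‖(∫ ω, Complex.exp (-markedSum w P X ω) ∂μ) - ∫ ω, Complex.exp (-markedSum w' P X ω) ∂μ‖ₑ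
      ≤ (∫⁻ p, ‖p‖ₑ ∂ν) * (ENNReal.ofReal lam * ∫⁻ x, ‖w x - w' x‖ₑ) := by
  have hint : ∀ {v : EuclideanSpace ℝ (Fin d) → ℂ}, Measurable v → Integrable v →
      (∀ x, 0 ≤ (v x).re) → Integrable (fun ω ↦ Complex.exp (-markedSum v P X ω)) μ := by
    intro v hv hvi hvre
    refine (integrable_const (1 : ℝ)).mono' (Complex.continuous_exp.comp_aestronglyMeasurable
      (h.aestronglyMeasurable_markedSum hm hv hvi).neg) ?_
    filter_upwards [h.re_markedSum_nonneg hν hvre] with ω hω using norm_exp_neg_le_one hω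
  rw [← integral_sub (hint hw hwi hre) (hint hw' hwi' hre')]
  refine (enorm_integral_le_lintegral_enorm _).trans ?_
  refine le_trans ?_ (h.lintegral_enorm_markedSum_le (hw.sub hw'))
  refine lintegral_mono_ae ?_
  filter_upwards [h.re_markedSum_nonneg hν hre, h.re_markedSum_nonneg hν hre',
    h.markedSum_sub hm hw hwi hw' hwi'] with ω h1 h2 h3
  rw [h3, enorm_le_iff_norm_le]
  exact norm_exp_neg_sub_exp_neg_le h1 h2

/-- The **Laplace functional** of a marked Poisson process, for complex test functions with
nonnegative real part. Simple functions reduce to the generating function of finitely many counts,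
and both sides are continuous in `L¹`. -/
theorem IsMarkedPoisson.integral_exp_neg_markedSum (h : IsMarkedPoisson X P lam ν μ)
    (hν : ν (Set.Iio 0) = 0) (hm : Integrable (fun p : ℝ ↦ p) ν) (hw : Measurable w)
    (hwi : Integrable w) (hre : ∀ x, 0 ≤ (w x).re) :
    ∫ ω, Complex.exp (-markedSum w P X ω) ∂μ
      = Complex.exp (lam * ∫ x, (complexLaplace ν (w x) - 1)) := by
  have hcl : IsClosed {c : ℂ | 0 ≤ c.re} := isClosed_le continuous_const Complex.continuous_re
  have h0 : (0 : ℂ) ∈ {c : ℂ | 0 ≤ c.re} := by simp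
  let f : ℕ → SimpleFunc (EuclideanSpace ℝ (Fin d)) ℂ :=
    SimpleFunc.approxOn w hw {c : ℂ | 0 ≤ c.re} 0 h0
  have hfre : ∀ k x, 0 ≤ (f k x).re := fun k x ↦ SimpleFunc.approxOn_mem hw h0 k x
  have hfi : ∀ k, Integrable (f k) := fun k ↦
    SimpleFunc.integrable_approxOn hw hwi h0 (by simp) k
  have hL1 : Tendsto (fun k ↦ ∫⁻ x, ‖f k x - w x‖ₑ) atTop (𝓝 0) := by
    refine SimpleFunc.tendsto_approxOn_L1_enorm hw h0 (ae_of_all _ fun x ↦ ?_) ?_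
    · exact subset_closure (hre x)
    · simpa using hwi.2
  have hconst : (∫⁻ p, ‖p‖ₑ ∂ν) * ENNReal.ofReal lam ≠ ⊤ :=
    ENNReal.mul_ne_top hm.2.ne ENNReal.ofReal_ne_top
  have hleft : Tendsto (fun k ↦ ∫ ω, Complex.exp (-markedSum (f k) P X ω) ∂μ) atTop
      (𝓝 (∫ ω, Complex.exp (-markedSum w P X ω) ∂μ)) := by
    rw [tendsto_iff_edist_tendsto_0]
    refine tendsto_of_tendsto_of_tendsto_of_le_of_le tendsto_const_nhds
      (h := fun k ↦ (∫⁻ p, ‖p‖ₑ ∂ν) * ENNReal.ofReal lam * ∫⁻ x, ‖f k x - w x‖ₑ) ?_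
      (fun _ ↦ zero_le) fun k ↦ ?_
    · simpa using ENNReal.Tendsto.const_mul hL1 (Or.inr hconst)
    · dsimp only
      rw [edist_eq_enorm_sub, mul_assoc]
      exact h.norm_integral_exp_neg_sub_le hν hm (f k).measurable (hfi k) (hfre k) hw hwi hre
  have hright : Tendsto (fun k ↦ ∫ x, (complexLaplace ν (f k x) - 1)) atTop
      (𝓝 (∫ x, (complexLaplace ν (w x) - 1))) := by
    refine tendsto_integral_of_L1 _
      (integrable_complexLaplace_sub_one hν hm hw hwi hre).aestronglyMeasurable
      (Eventually.of_forall fun k ↦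
        integrable_complexLaplace_sub_one hν hm (f k).measurable (hfi k) (hfre k)) ?_
    refine tendsto_of_tendsto_of_tendsto_of_le_of_le tendsto_const_nhds
      (h := fun k ↦ ENNReal.ofReal (∫ p, p ∂ν) * ∫⁻ x, ‖f k x - w x‖ₑ) ?_
      (fun _ ↦ zero_le) fun k ↦ ?_
    · simpa using ENNReal.Tendsto.const_mul hL1 (Or.inr ENNReal.ofReal_ne_top)
    · dsimp only
      rw [← lintegral_const_mul' _ _ ENNReal.ofReal_ne_top]
      refine lintegral_mono fun x ↦ ?_
      have := norm_complexLaplace_sub_le hν hm (hfre k x) (hre x)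
      rw [sub_sub_sub_cancel_right, ← ofReal_norm, ← ofReal_norm,
        ← ENNReal.ofReal_mul' (norm_nonneg _)]
      exact ENNReal.ofReal_le_ofReal this
  have hright' := (Complex.continuous_exp.tendsto _).comp (hright.const_mul (lam : ℂ))
  refine tendsto_nhds_unique hleft (hright'.congr fun k ↦ ?_)
  exact (h.integral_exp_neg_markedSum_simpleFunc hν hm (f k) (hfi k) (hfre k)).symm

end Marked

/-! ### Regular variation of the tail and of the normalising function -/

section Tail

variable {ν : Measure ℝ} [IsProbabilityMeasure ν]

lemma antitone_tail : Antitone (tail ν) := fun _ _ hst ↦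
  sub_le_sub_left (monotone_cdf ν hst) 1

lemma tail_le_one (t : ℝ) : tail ν t ≤ 1 := by
  have := cdf_nonneg ν t
  rw [tail]
  linarith

lemma tail_pos {ρ : ℝ} (h : IsRegularlyVarying (tail ν) ρ) (t : ℝ) : 0 < tail ν t := by
  obtain ⟨s, hs, hts⟩ := (h.1.and (eventually_ge_atTop t)).exists
  exact hs.trans_le (antitone_tail hts)

end Tail

section RegularVariation

variable {T g : ℝ → ℝ} {α : ℝ}

/-- The asymptotic inverse tends to infinity: `1 / T` is monotone, hence bounded below any level,
whereas `1 / T (g x)` grows like `x`. -/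
lemma tendsto_atTop_of_isAsymptoticInverse (hT : Antitone T) (hpos : ∀ t, 0 < T t)
    (hg : IsAsymptoticInverse g fun t ↦ 1 / T t) : Tendsto g atTop atTop := by
  have h := hg.1.symm.tendsto_atTop tendsto_id
  rw [tendsto_atTop]
  intro M
  filter_upwards [h.eventually_gt_atTop (1 / T M)] with x hx
  by_contra hlt
  rw [not_le] at hlt
  exact absurd (one_div_le_one_div_of_le (hpos _) (hT hlt.le)) (not_le.2 hx)

lemma tendsto_mul_comp_one (hpos : ∀ t, 0 < T t) (hg : IsAsymptoticInverse g fun t ↦ 1 / T t) :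
    Tendsto (fun x ↦ x * T (g x)) atTop (𝓝 1) := by
  have h := (isEquivalent_iff_tendsto_one (by
    filter_upwards [eventually_ne_atTop 0] with x hx using hx)).1 hg.1
  have h' := h.inv₀ one_ne_zero
  rw [inv_one] at h'
  refine h'.congr fun x ↦ ?_
  have := (hpos (g x)).ne'
  simp only [Pi.div_apply]
  field_simp

/-- The jump measure on the scale `g x`, multiplied by `x`, has limiting tail `u ^ (-α)`. -/
lemma tendsto_mul_comp_rpow (hpos : ∀ t, 0 < T t) (hreg : IsRegularlyVarying T (-α))
    (hanti : Antitone T) (hg : IsAsymptoticInverse g fun t ↦ 1 / T t) {u : ℝ} (hu : 0 < u) :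
    Tendsto (fun x ↦ x * T (u * g x)) atTop (𝓝 (u ^ (-α))) := by
  have h := ((hreg.2 u hu).comp (tendsto_atTop_of_isAsymptoticInverse hanti hpos hg)).mul
    (tendsto_mul_comp_one hpos hg)
  rw [mul_one] at h
  refine h.congr fun x ↦ ?_
  have := (hpos (g x)).ne'
  simp only [Function.comp_apply]
  field_simp

/-- An asymptotic inverse of a monotone function of regular variation with index `α` is regularly
varying with index `1 / α`: the tail separates `g (c * x)` from every other multiple of `g x`. -/
theorem isRegularlyVarying_asymptoticInverse (hα : 0 < α) (hpos : ∀ t, 0 < T t)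
    (hreg : IsRegularlyVarying T (-α)) (hanti : Antitone T)
    (hg : IsAsymptoticInverse g fun t ↦ 1 / T t) : IsRegularlyVarying g (1 / α) := by
  have hginf := tendsto_atTop_of_isAsymptoticInverse hanti hpos hg
  refine ⟨hginf.eventually_gt_atTop 0, fun c hc ↦ ?_⟩
  have hcx : Tendsto (fun x : ℝ ↦ c * x) atTop atTop := tendsto_id.const_mul_atTop hc
  have h1 : Tendsto (fun x ↦ x * T (g (c * x))) atTop (𝓝 c⁻¹) := by
    have h := ((tendsto_mul_comp_one hpos hg).comp hcx).const_mul c⁻¹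
    rw [mul_one] at h
    refine h.congr fun x ↦ ?_
    simp only [Function.comp_apply]
    field_simp
  have hpow : ∀ b : ℝ, 0 < b → b ^ (-α) = (b ^ α)⁻¹ := fun b hb ↦ Real.rpow_neg hb.le α
  have hcα : (c ^ (1 / α)) ^ α = c := by
    rw [← Real.rpow_mul hc.le, one_div_mul_cancel hα.ne', Real.rpow_one]
  have hc0 : 0 < c ^ (1 / α) := Real.rpow_pos_of_pos hc _
  rw [tendsto_order]
  constructor
  · intro a ha
    obtain ⟨b, hb, hbc⟩ := exists_between (max_lt ha hc0)
    obtain ⟨hab, hb0⟩ := max_lt_iff.1 hb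
    have hbα : b ^ α < c := by
      rw [← hcα]
      exact Real.rpow_lt_rpow hb0.le hbc hα
    have hlt : c⁻¹ < b ^ (-α) := by
      rw [hpow b hb0]
      exact inv_strictAnti₀ (Real.rpow_pos_of_pos hb0 _) hbα
    filter_upwards [h1.eventually_lt (tendsto_mul_comp_rpow hpos hreg hanti hg hb0) hlt,
      eventually_gt_atTop 0, hginf.eventually_gt_atTop 0] with x hx hx0 hgx
    have hT := lt_of_mul_lt_mul_left hx hx0.le
    have : b * g x < g (c * x) := by
      by_contra hle
      exact absurd (hanti (not_lt.1 hle)) (not_le.2 hT)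
    exact hab.trans ((lt_div_iff₀ hgx).2 this)
  · intro b hbc
    have hb0 := hc0.trans hbc
    have hbα : c < b ^ α := by
      rw [← hcα]
      exact Real.rpow_lt_rpow hc0.le hbc hα
    have hlt : b ^ (-α) < c⁻¹ := by
      rw [hpow b hb0]
      exact inv_strictAnti₀ hc hbα
    filter_upwards [(tendsto_mul_comp_rpow hpos hreg hanti hg hb0).eventually_lt h1 hlt,
      eventually_gt_atTop 0, hginf.eventually_gt_atTop 0] with x hx hx0 hgx
    have hT := lt_of_mul_lt_mul_left hx hx0.le
    have : g (c * x) < b * g x := by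
      by_contra hle
      exact absurd (hanti (not_lt.1 hle)) (not_le.2 hT)
    exact (div_lt_iff₀ hgx).2 this

/-- **Potter's bounds** for a bounded monotone function of regular variation. Iterating the
asymptotic doubling relation controls dyadic multiples, and monotonicity the others. -/
theorem exists_potter_bound (hpos : ∀ t, 0 < T t) (hle : ∀ t, T t ≤ 1)
    (hreg : IsRegularlyVarying T (-α)) (hanti : Antitone T) {δ : ℝ} (hδ : 0 < δ) (hδα : δ < α) :
    ∃ C t₀ : ℝ, 0 < C ∧ 0 < t₀ ∧ ∀ t, t₀ ≤ t → ∀ u, 0 < u →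
      T (u * t) ≤ C * (u ^ (-(α + δ)) + u ^ (-(α - δ))) * T t := by
  have h2 := hreg.2 2 two_pos
  have hup : ∀ᶠ t in atTop, T (2 * t) / T t < 2 ^ (-(α - δ)) :=
    h2.eventually_lt_const (Real.rpow_lt_rpow_of_exponent_lt one_lt_two (by linarith))
  have hlow : ∀ᶠ t in atTop, 2 ^ (-(α + δ)) < T (2 * t) / T t :=
    h2.eventually_const_lt (Real.rpow_lt_rpow_of_exponent_lt one_lt_two (by linarith))
  obtain ⟨t₁, ht₁⟩ := eventually_atTop.1 (hup.and hlow)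
  set t₀ := max t₁ 1 with ht₀
  have ht₀pos : 0 < t₀ := lt_max_of_lt_right one_pos
  have hdbl : ∀ t, t₀ ≤ t → ∀ k : ℕ, t₀ ≤ 2 ^ k * t := fun t ht k ↦ by
    have h1 : (1 : ℝ) ≤ 2 ^ k := one_le_pow₀ one_le_two
    nlinarith
  have hiter1 : ∀ k : ℕ, ∀ t, t₀ ≤ t → T (2 ^ k * t) ≤ ((2 : ℝ) ^ k) ^ (-(α - δ)) * T t := by
    intro k t ht
    induction k with
    | zero => simp
    | succ k ih =>
      have h := (ht₁ (2 ^ k * t) ((le_max_left _ _).trans (hdbl t ht k))).1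
      rw [div_lt_iff₀ (hpos _)] at h
      rw [pow_succ', mul_assoc, Real.mul_rpow two_pos.le (by positivity), mul_assoc]
      exact h.le.trans (mul_le_mul_of_nonneg_left ih (by positivity))
  have hiter2 : ∀ k : ℕ, ∀ t, t₀ ≤ t → T t ≤ ((2 : ℝ) ^ k) ^ (α + δ) * T (2 ^ k * t) := by
    intro k t ht
    induction k with
    | zero => simp
    | succ k ih =>
      have h := (ht₁ (2 ^ k * t) ((le_max_left _ _).trans (hdbl t ht k))).2
      rw [lt_div_iff₀ (hpos _), Real.rpow_neg two_pos.le, inv_mul_lt_iff₀ (by positivity)] at h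
      rw [pow_succ', mul_assoc, Real.mul_rpow two_pos.le (by positivity),
        mul_comm ((2 : ℝ) ^ (α + δ)), mul_assoc]
      exact ih.trans (mul_le_mul_of_nonneg_left h.le (by positivity))
  have hsmall : ∀ t, ∀ u, 0 < u → u ≤ 1 → t₀ ≤ u * t →
      T (u * t) ≤ 2 ^ (α + δ) * u ^ (-(α + δ)) * T t := by
    intro t u hu hu1 hut
    obtain ⟨k, hk1, hk2⟩ := exists_nat_pow_near (x := u⁻¹) (y := (2 : ℝ))
      ((one_le_inv₀ hu).2 hu1) one_lt_two
    have hbig : 1 ≤ 2 ^ (k + 1) * u := by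
      have := mul_lt_mul_of_pos_right hk2 hu
      rw [inv_mul_cancel₀ hu.ne'] at this
      exact this.le
    have htpos : 0 < t := by
      by_contra hneg
      nlinarith
    have hmono : T (2 ^ (k + 1) * (u * t)) ≤ T t := by
      refine hanti ?_
      rw [← mul_assoc]
      exact le_mul_of_one_le_left htpos.le hbig
    have hpw : ((2 : ℝ) ^ (k + 1)) ^ (α + δ) ≤ 2 ^ (α + δ) * u ^ (-(α + δ)) := by
      rw [Real.rpow_neg hu.le, ← Real.inv_rpow hu.le, ← Real.mul_rpow two_pos.le (by positivity)]
      refine Real.rpow_le_rpow (by positivity) ?_ (by linarith)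
      rw [pow_succ']
      exact mul_le_mul_of_nonneg_left hk1 two_pos.le
    exact (hiter2 (k + 1) _ hut).trans
      (mul_le_mul hpw hmono (hpos _).le (by positivity))
  have hlarge : ∀ t, t₀ ≤ t → ∀ u, 1 ≤ u → T (u * t) ≤ 2 ^ (α - δ) * u ^ (-(α - δ)) * T t := by
    intro t ht u hu1
    have hu : 0 < u := one_pos.trans_le hu1
    obtain ⟨k, hk1, hk2⟩ := exists_nat_pow_near hu1 (one_lt_two (α := ℝ))
    have htpos : 0 < t := ht₀pos.trans_le ht
    have hmono : T (u * t) ≤ T (2 ^ k * t) := hanti (mul_le_mul_of_nonneg_right hk1 htpos.le)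
    have hpw : ((2 : ℝ) ^ k) ^ (-(α - δ)) ≤ 2 ^ (α - δ) * u ^ (-(α - δ)) := by
      have h1 : u / 2 ≤ 2 ^ k := by
        rw [pow_succ'] at hk2
        linarith
      have h3 := Real.rpow_le_rpow_of_nonpos (by positivity) h1 (z := -(α - δ)) (by linarith)
      refine h3.trans_eq ?_
      rw [Real.div_rpow hu.le two_pos.le, Real.rpow_neg two_pos.le]
      field_simp
    exact hmono.trans ((hiter1 k t ht).trans (mul_le_mul_of_nonneg_right hpw (hpos _).le))
  refine ⟨2 ^ (α + δ) * (T t₀)⁻¹ + 2 ^ (α - δ), t₀, by have := hpos t₀; positivity, ht₀pos,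
    fun t ht u hu ↦ ?_⟩
  have hTt := hpos t
  have hTt₀ := hpos t₀
  have hinv : 1 ≤ (T t₀)⁻¹ := (one_le_inv₀ hTt₀).2 (hle _)
  have htpos : 0 < t := ht₀pos.trans_le ht
  have hA : 0 < u ^ (-(α + δ)) := Real.rpow_pos_of_pos hu _
  have hB : 0 < u ^ (-(α - δ)) := Real.rpow_pos_of_pos hu _
  have hc1 : (0 : ℝ) < 2 ^ (α + δ) := by positivity
  have hc2 : (0 : ℝ) < 2 ^ (α - δ) := by positivity
  rcases le_total 1 u with hu1 | hu1
  · refine (hlarge t ht u hu1).trans (mul_le_mul_of_nonneg_right ?_ hTt.le)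
    refine mul_le_mul ?_ ?_ hB.le (by positivity)
    · linarith [show 0 < 2 ^ (α + δ) * (T t₀)⁻¹ by positivity]
    · linarith
  · have key : T (u * t) ≤ 2 ^ (α + δ) * (T t₀)⁻¹ * u ^ (-(α + δ)) * T t := by
      rcases le_total t₀ (u * t) with hut | hut
      · refine (hsmall t u hu hu1 hut).trans (mul_le_mul_of_nonneg_right ?_ hTt.le)
        exact mul_le_mul_of_nonneg_right (le_mul_of_one_le_right hc1.le hinv) hA.le
      · have h1 := hsmall t (t₀ / t) (by positivity) ((div_le_one htpos).2 ht)
          (by rw [div_mul_cancel₀ _ htpos.ne'])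
        rw [div_mul_cancel₀ _ htpos.ne'] at h1
        have h3 : (t₀ / t) ^ (-(α + δ)) ≤ u ^ (-(α + δ)) :=
          Real.rpow_le_rpow_of_nonpos hu ((le_div_iff₀ htpos).2 hut) (by linarith)
        have h4 : T t₀ ≤ 2 ^ (α + δ) * u ^ (-(α + δ)) * T t :=
          h1.trans (mul_le_mul_of_nonneg_right (mul_le_mul_of_nonneg_left h3 hc1.le) hTt.le)
        calc T (u * t) ≤ 1 := hle _
          _ = (T t₀)⁻¹ * T t₀ := (inv_mul_cancel₀ hTt₀.ne').symm
          _ ≤ (T t₀)⁻¹ * (2 ^ (α + δ) * u ^ (-(α + δ)) * T t) := by gcongr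
          _ = _ := by ring
    refine key.trans (mul_le_mul_of_nonneg_right ?_ hTt.le)
    refine mul_le_mul ?_ ?_ hA.le (by positivity)
    · linarith
    · linarith

end RegularVariation

/-! ### The limit of the rescaled centred Laplace exponent -/

/-- The centred Laplace transform `E[exp (-c p) - 1 + c p]` of a law on the line. -/
noncomputable def centeredLaplace (ν : Measure ℝ) (c : ℂ) : ℂ :=
  complexLaplace ν c - 1 + ((∫ p, p ∂ν : ℝ) : ℂ) * c

/-- The exponent of a totally skewed `α`-stable law, written after one integration by parts as an
integral against `u ^ (-α)`, the limit of the tail of the jump law. -/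
noncomputable def stableExponent (α : ℝ) (θ : ℂ) : ℂ :=
  ∫ u in Set.Ioi (0 : ℝ), θ * (1 - Complex.exp (-((u : ℂ) * θ))) * ((u ^ (-α) : ℝ) : ℂ)

lemma norm_mul_one_sub_exp_le {θ : ℂ} (hθ : 0 ≤ θ.re) {u : ℝ} (hu : 0 ≤ u) :
    ‖θ * (1 - Complex.exp (-((u : ℂ) * θ)))‖ ≤ ‖θ‖ * min 2 (u * ‖θ‖) := by
  rw [norm_mul]
  refine mul_le_mul_of_nonneg_left (le_min ?_ ?_) (norm_nonneg _)
  · refine (norm_sub_le _ _).trans ?_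
    have := norm_exp_neg_le_one (re_ofReal_mul_nonneg hu hθ)
    rw [norm_one]
    linarith
  · have := norm_exp_neg_sub_exp_neg_le (a := 0) le_rfl (re_ofReal_mul_nonneg hu hθ)
    simpa [abs_of_nonneg hu] using this

lemma setIntegral_Ioi_indicator_Iio (c : ℂ) {p : ℝ} (hp : 0 ≤ p) :
    ∫ u in Set.Ioi (0 : ℝ), (Set.Iio p).indicator
        (fun u : ℝ ↦ c * (1 - Complex.exp (-((u : ℂ) * c)))) u
      = Complex.exp (-((p : ℂ) * c)) - 1 + p * c := by
  rw [setIntegral_indicator measurableSet_Iio, Set.Ioi_inter_Iio, ← integral_Ioc_eq_integral_Ioo,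
    ← intervalIntegral.integral_of_le hp]
  have hderiv : ∀ u ∈ Set.uIcc 0 p, HasDerivAt
      (fun u : ℝ ↦ Complex.exp (-((u : ℂ) * c)) + u * c)
      (c * (1 - Complex.exp (-((u : ℂ) * c)))) u := fun u _ ↦ by
    have h1 : HasDerivAt (fun u : ℝ ↦ (u : ℂ) * c) (1 * c) u :=
      (Complex.ofRealCLM.hasDerivAt (x := u)).mul_const c
    have h2 := h1.fun_neg.cexp.add h1
    refine h2.congr_deriv ?_
    ring
  rw [intervalIntegral.integral_eq_sub_of_hasDerivAt hderiv
    ((by fun_prop : Continuous _).intervalIntegrable _ _)]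
  simp
  ring

section

variable {ν : Measure ℝ} [IsProbabilityMeasure ν]

/-- Integration by parts: the centred Laplace transform as an integral of the tail. -/
lemma centeredLaplace_eq_setIntegral_tail (hν : ν (Set.Iio 0) = 0)
    (hm : Integrable (fun p : ℝ ↦ p) ν) {c : ℂ} (hc : 0 ≤ c.re) :
    centeredLaplace ν c
      = ∫ u in Set.Ioi (0 : ℝ), c * (1 - Complex.exp (-((u : ℂ) * c))) * (tail ν u : ℂ) := by
  let f : ℝ → ℂ := fun u ↦ c * (1 - Complex.exp (-((u : ℂ) * c)))
  have hf : Measurable f := by fun_prop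
  let F : ℝ → ℝ → ℂ := fun p u ↦ (Set.Iio p).indicator f u
  have hset : MeasurableSet {q : ℝ × ℝ | q.2 < q.1} :=
    measurableSet_lt measurable_snd measurable_fst
  have hFm : Measurable (Function.uncurry F) := by
    have : Function.uncurry F = {q : ℝ × ℝ | q.2 < q.1}.indicator fun q ↦ f q.2 := by
      ext q
      simp only [Function.uncurry, F, Set.indicator_apply, Set.mem_Iio, Set.mem_ofPred_eq]
    rw [this]
    exact (hf.comp measurable_snd).indicator hset
  have hFb : ∀ p, 0 ≤ p → ∀ u ∈ Set.Ioi (0 : ℝ),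
      ‖F p u‖ ≤ (Set.Iio p).indicator (fun _ ↦ 2 * ‖c‖) u := fun p _ u hu ↦ by
    simp only [F]
    rw [norm_indicator_eq_indicator_norm]
    refine Set.indicator_le_indicator ?_
    refine (norm_mul_one_sub_exp_le hc (le_of_lt hu)).trans ?_
    rw [mul_comm 2]
    exact mul_le_mul_of_nonneg_left (min_le_left _ _) (norm_nonneg _)
  have hconst : ∀ p, 0 ≤ p → IntegrableOn ((Set.Iio p).indicator fun _ : ℝ ↦ 2 * ‖c‖)
      (Set.Ioi 0) := fun p _ ↦ by
    rw [IntegrableOn, integrable_indicator_iff measurableSet_Iio, IntegrableOn,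
      Measure.restrict_restrict measurableSet_Iio, Set.inter_comm, Set.Ioi_inter_Iio]
    exact integrable_const _
  have hconst' : ∀ p, 0 ≤ p → ∫ u in Set.Ioi (0 : ℝ), (Set.Iio p).indicator (fun _ ↦ 2 * ‖c‖) u
      = p * (2 * ‖c‖) := fun p hp ↦ by
    rw [setIntegral_indicator measurableSet_Iio, Set.Ioi_inter_Iio, setIntegral_const]
    simp [hp]
  have hFi : Integrable (Function.uncurry F) (ν.prod (volume.restrict (Set.Ioi 0))) := by
    rw [integrable_prod_iff hFm.aestronglyMeasurable]
    constructor
    · filter_upwards [ae_nonneg_of_measure_Iio hν] with p hp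
      refine (hconst p hp).mono' (hFm.comp measurable_prodMk_left).aestronglyMeasurable ?_
      exact (ae_restrict_iff' measurableSet_Ioi).2 (ae_of_all _ (hFb p hp))
    · refine (hm.mul_const (2 * ‖c‖)).mono'
        (hFm.norm.stronglyMeasurable.integral_prod_right).aestronglyMeasurable ?_
      filter_upwards [ae_nonneg_of_measure_Iio hν] with p hp
      rw [Real.norm_of_nonneg (integral_nonneg fun _ ↦ norm_nonneg _), ← hconst' p hp]
      refine integral_mono_of_nonneg (ae_of_all _ fun _ ↦ norm_nonneg _) (hconst p hp) ?_
      exact (ae_restrict_iff' measurableSet_Ioi).2 (ae_of_all _ (hFb p hp))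
  have hswap := integral_integral_swap hFi
  have hleft : ∫ p, (∫ u in Set.Ioi (0 : ℝ), F p u) ∂ν = centeredLaplace ν c := by
    rw [centeredLaplace, complexLaplace, integral_congr_ae
      (g := fun p : ℝ ↦ Complex.exp (-((p : ℂ) * c)) - 1 + p * c)]
    · have hi : Integrable (fun p : ℝ ↦ Complex.exp (-((p : ℂ) * c)) - 1) ν :=
        (integrable_exp_neg_mul hν hc).sub (integrable_const _)
      have hi' : Integrable (fun p : ℝ ↦ (p : ℂ) * c) ν := hm.ofReal.mul_const c
      rw [integral_add hi hi', integral_sub (integrable_exp_neg_mul hν hc) (integrable_const _),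
        integral_mul_const, integral_complex_ofReal]
      simp
    · filter_upwards [ae_nonneg_of_measure_Iio hν] with p hp
      exact setIntegral_Ioi_indicator_Iio c hp
  rw [← hleft, hswap]
  congr 1
  ext u
  have h1 : ∀ p, F p u = (Set.Ioi u).indicator (fun _ ↦ f u) p := fun p ↦ by
    simp [F, Set.indicator_apply]
  simp_rw [h1]
  rw [integral_indicator_const _ measurableSet_Ioi, Complex.real_smul, mul_comm]
  congr 2
  rw [tail, cdf_eq_real, ← Set.compl_Iic, probReal_compl_eq_one_sub measurableSet_Iic]

lemma integrableOn_min_mul_rpow {B β : ℝ} (hB : 0 ≤ B) (h1 : 1 < β) (h2 : β < 2) :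
    IntegrableOn (fun u : ℝ ↦ min 2 (u * B) * u ^ (-β)) (Set.Ioi 0) := by
  have hmeas : Measurable fun u : ℝ ↦ min 2 (u * B) * u ^ (-β) := by fun_prop
  rw [← Set.Ioc_union_Ioi_eq_Ioi zero_le_one, integrableOn_union]
  constructor
  · have hi : IntegrableOn (fun u : ℝ ↦ B * u ^ (1 - β)) (Set.Ioc 0 1) := by
      rw [← intervalIntegrable_iff_integrableOn_Ioc_of_le zero_le_one]
      exact (intervalIntegral.intervalIntegrable_rpow' (by linarith)).const_mul B
    refine hi.mono' hmeas.aestronglyMeasurable ?_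
    refine (ae_restrict_iff' measurableSet_Ioc).2 (ae_of_all _ fun u hu ↦ ?_)
    have hu0 : 0 < u := hu.1
    rw [Real.norm_of_nonneg (by positivity)]
    have h3 : u ^ (1 - β) = u * u ^ (-β) := by
      rw [sub_eq_add_neg, Real.rpow_add hu0, Real.rpow_one]
    rw [h3, ← mul_assoc, mul_comm B]
    exact mul_le_mul_of_nonneg_right (min_le_right _ _) (by positivity)
  · have hi : IntegrableOn (fun u : ℝ ↦ 2 * u ^ (-β)) (Set.Ioi 1) :=
      (integrableOn_Ioi_rpow_of_lt (by linarith) one_pos).const_mul 2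
    refine hi.mono' hmeas.aestronglyMeasurable ?_
    refine (ae_restrict_iff' measurableSet_Ioi).2 (ae_of_all _ fun u hu ↦ ?_)
    have hu0 : 0 < u := one_pos.trans hu
    rw [Real.norm_of_nonneg (by positivity)]
    exact mul_le_mul_of_nonneg_right (min_le_left _ _) (by positivity)

lemma mul_centeredLaplace_div_eq (hν : ν (Set.Iio 0) = 0) (hm : Integrable (fun p : ℝ ↦ p) ν)
    {θ : ℂ} (hθ : 0 ≤ θ.re) (x : ℝ) {a : ℝ} (ha : 0 < a) :
    (x : ℂ) * centeredLaplace ν (θ / a)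
      = ∫ u in Set.Ioi (0 : ℝ), θ * (1 - Complex.exp (-((u : ℂ) * θ)))
          * ((x * tail ν (u * a) : ℝ) : ℂ) := by
  have hre : 0 ≤ (θ / a).re := by
    rw [Complex.div_ofReal_re]
    positivity
  have ha' : (a : ℂ) ≠ 0 := by exact_mod_cast ha.ne'
  rw [centeredLaplace_eq_setIntegral_tail hν hm hre]
  have h := integral_comp_mul_left_Ioi
    (fun u : ℝ ↦ θ / a * (1 - Complex.exp (-((u : ℂ) * (θ / a)))) * (tail ν u : ℂ)) 0 ha
  rw [mul_zero] at h
  have h' : ∫ u in Set.Ioi (0 : ℝ), θ / a * (1 - Complex.exp (-((u : ℂ) * (θ / a))))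
      * (tail ν u : ℂ) = a * ∫ u in Set.Ioi (0 : ℝ), θ / a
        * (1 - Complex.exp (-(((a * u : ℝ) : ℂ) * (θ / a)))) * (tail ν (a * u) : ℂ) := by
    rw [h, Complex.real_smul, ← mul_assoc, ← Complex.ofReal_mul, mul_inv_cancel₀ ha.ne']
    simp
  rw [h', ← integral_const_mul, ← integral_const_mul]
  congr 1
  ext u
  have h1 : (((a * u : ℝ) : ℂ) * (θ / a)) = u * θ := by
    push_cast
    field_simp
  rw [h1, mul_comm u a]
  push_cast
  field_simp

variable {α : ℝ} {g : ℝ → ℝ}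

/-- The rescaled tails are eventually dominated by a function which is integrable at the origin
against `u` and at infinity against constants; this is where `1 < α < 2` is used. -/
lemma exists_bound_mul_tail (hα₁ : 1 < α) (hα₂ : α < 2)
    (hreg : IsRegularlyVarying (tail ν) (-α))
    (hg : IsAsymptoticInverse g fun t ↦ 1 / tail ν t) :
    ∃ D : ℝ → ℝ, (∀ u, 0 < u → 0 ≤ D u) ∧
      (∀ B, 0 ≤ B → IntegrableOn (fun u ↦ min 2 (u * B) * D u) (Set.Ioi 0)) ∧
      ∀ᶠ x in atTop, 0 < g x ∧ ∀ u, 0 < u → |x * tail ν (u * g x)| ≤ D u := by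
  set δ := min (2 - α) (α - 1) / 2 with hδdef
  have hδ1 : δ < 2 - α := by
    have h1 := min_le_left (2 - α) (α - 1)
    linarith
  have hδ2 : δ < α - 1 := by
    have h1 := min_le_right (2 - α) (α - 1)
    linarith
  have hδ : 0 < δ := by
    have : 0 < min (2 - α) (α - 1) := lt_min (by linarith) (by linarith)
    positivity
  have hpos := tail_pos hreg
  obtain ⟨C, t₀, hC, ht₀, hpot⟩ := exists_potter_bound hpos tail_le_one hreg antitone_tail hδ
    (by linarith : δ < α)
  have hginf := tendsto_atTop_of_isAsymptoticInverse antitone_tail hpos hg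
  refine ⟨fun u ↦ 2 * C * (u ^ (-(α + δ)) + u ^ (-(α - δ))), fun u hu ↦ by positivity,
    fun B hB ↦ ?_, ?_⟩
  · have h1 := integrableOn_min_mul_rpow hB (β := α + δ) (by linarith) (by linarith)
    have h2 := integrableOn_min_mul_rpow hB (β := α - δ) (by linarith) (by linarith)
    refine ((h1.add h2).const_mul (2 * C)).congr (ae_of_all _ fun u ↦ ?_)
    simp only [Pi.add_apply]
    ring
  · filter_upwards [hginf.eventually_ge_atTop t₀, eventually_gt_atTop 0,
      (tendsto_mul_comp_one hpos hg).eventually_lt_const one_lt_two] with x hx hx0 hx2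
    refine ⟨ht₀.trans_le hx, fun u hu ↦ ?_⟩
    have hA : 0 < u ^ (-(α + δ)) + u ^ (-(α - δ)) := by positivity
    rw [abs_of_nonneg (mul_nonneg hx0.le (hpos _).le)]
    calc x * tail ν (u * g x)
        ≤ x * (C * (u ^ (-(α + δ)) + u ^ (-(α - δ))) * tail ν (g x)) :=
          mul_le_mul_of_nonneg_left (hpot _ hx u hu) hx0.le
      _ = C * (u ^ (-(α + δ)) + u ^ (-(α - δ))) * (x * tail ν (g x)) := by ring
      _ ≤ C * (u ^ (-(α + δ)) + u ^ (-(α - δ))) * 2 :=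
          mul_le_mul_of_nonneg_left hx2.le (by positivity)
      _ = _ := by ring

/-- The centred Laplace exponents, rescaled by the asymptotic inverse of the tail, converge to the
stable exponent. -/
theorem tendsto_mul_centeredLaplace (hν : ν (Set.Iio 0) = 0)
    (hm : Integrable (fun p : ℝ ↦ p) ν) (hα₁ : 1 < α) (hα₂ : α < 2)
    (hreg : IsRegularlyVarying (tail ν) (-α))
    (hg : IsAsymptoticInverse g fun t ↦ 1 / tail ν t) {θ : ℂ} (hθ : 0 ≤ θ.re) :
    Tendsto (fun x : ℝ ↦ (x : ℂ) * centeredLaplace ν (θ / g x)) atTop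
      (𝓝 (stableExponent α θ)) := by
  obtain ⟨D, hD0, hDi, hD⟩ := exists_bound_mul_tail hα₁ hα₂ hreg hg
  have hpos := tail_pos hreg
  have h : Tendsto (fun x : ℝ ↦ ∫ u in Set.Ioi (0 : ℝ), θ * (1 - Complex.exp (-((u : ℂ) * θ)))
      * ((x * tail ν (u * g x) : ℝ) : ℂ)) atTop (𝓝 (stableExponent α θ)) := by
    refine tendsto_integral_filter_of_dominated_convergence
      (fun u ↦ ‖θ‖ * (min 2 (u * ‖θ‖) * D u)) (Eventually.of_forall fun x ↦ ?_) ?_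
      ((hDi _ (norm_nonneg θ)).const_mul ‖θ‖) ?_
    · have : Measurable (tail ν) := antitone_tail.measurable
      exact (by fun_prop : Measurable _).aestronglyMeasurable
    · filter_upwards [hD] with x hx
      refine (ae_restrict_iff' measurableSet_Ioi).2 (ae_of_all _ fun u hu ↦ ?_)
      rw [norm_mul, Complex.norm_real, ← mul_assoc, Real.norm_eq_abs]
      exact mul_le_mul (norm_mul_one_sub_exp_le hθ (le_of_lt hu)) (hx.2 u hu) (abs_nonneg _)
        (mul_nonneg (norm_nonneg _) (le_min zero_le_two (mul_nonneg (le_of_lt hu) (norm_nonneg _))))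
    · refine (ae_restrict_iff' measurableSet_Ioi).2 (ae_of_all _ fun u hu ↦ ?_)
      exact ((Complex.continuous_ofReal.tendsto _).comp
        (tendsto_mul_comp_rpow hpos hreg antitone_tail hg hu)).const_mul _
  refine h.congr' ?_
  filter_upwards [hD] with x hx
  exact (mul_centeredLaplace_div_eq hν hm hθ x hx.1).symm

/-- A bound on the rescaled exponents which is linear in `θ`, so that composition with an integrable
test function stays dominated by an integrable function. -/
lemma exists_norm_mul_centeredLaplace_le (hν : ν (Set.Iio 0) = 0)
    (hm : Integrable (fun p : ℝ ↦ p) ν) (hα₁ : 1 < α) (hα₂ : α < 2)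
    (hreg : IsRegularlyVarying (tail ν) (-α))
    (hg : IsAsymptoticInverse g fun t ↦ 1 / tail ν t) {B : ℝ} (hB : 0 ≤ B) :
    ∃ C : ℝ, 0 ≤ C ∧ ∀ᶠ x : ℝ in atTop, 0 < g x ∧ ∀ θ : ℂ, 0 ≤ θ.re → ‖θ‖ ≤ B →
      ‖(x : ℂ) * centeredLaplace ν (θ / g x)‖ ≤ C * ‖θ‖ := by
  obtain ⟨D, hD0, hDi, hD⟩ := exists_bound_mul_tail hα₁ hα₂ hreg hg
  refine ⟨∫ u in Set.Ioi (0 : ℝ), min 2 (u * B) * D u, setIntegral_nonneg measurableSet_Ioi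
    fun u hu ↦ mul_nonneg (le_min zero_le_two (mul_nonneg (le_of_lt hu) hB)) (hD0 u hu), ?_⟩
  filter_upwards [hD] with x hx
  refine ⟨hx.1, fun θ hθ hθB ↦ ?_⟩
  rw [mul_centeredLaplace_div_eq hν hm hθ x hx.1, mul_comm _ ‖θ‖, ← integral_const_mul]
  refine norm_integral_le_of_norm_le ((hDi B hB).const_mul ‖θ‖) ?_
  refine (ae_restrict_iff' measurableSet_Ioi).2 (ae_of_all _ fun u hu ↦ ?_)
  have hu0 : (0 : ℝ) ≤ u := le_of_lt hu
  rw [norm_mul, Complex.norm_real, ← mul_assoc, Real.norm_eq_abs]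
  refine mul_le_mul ((norm_mul_one_sub_exp_le hθ hu0).trans ?_) (hx.2 u hu) (abs_nonneg _)
    (mul_nonneg (norm_nonneg _) (le_min zero_le_two (mul_nonneg hu0 hB)))
  exact mul_le_mul_of_nonneg_left (min_le_min_left _ (mul_le_mul_of_nonneg_left hθB hu0))
    (norm_nonneg _)

end

lemma stableExponent_zero (α : ℝ) : stableExponent α 0 = 0 := by simp [stableExponent]

lemma norm_stableExponent_le {α : ℝ} (hα₁ : 1 < α) (hα₂ : α < 2) {B : ℝ} (hB : 0 ≤ B) {θ : ℂ}
    (hθ : 0 ≤ θ.re) (hθB : ‖θ‖ ≤ B) :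
    ‖stableExponent α θ‖ ≤ (∫ u in Set.Ioi (0 : ℝ), min 2 (u * B) * u ^ (-α)) * ‖θ‖ := by
  rw [mul_comm _ ‖θ‖, ← integral_const_mul]
  refine norm_integral_le_of_norm_le ((integrableOn_min_mul_rpow hB hα₁ hα₂).const_mul ‖θ‖) ?_
  refine (ae_restrict_iff' measurableSet_Ioi).2 (ae_of_all _ fun u hu ↦ ?_)
  have hu0 : (0 : ℝ) < u := hu
  rw [norm_mul, Complex.norm_real, ← mul_assoc, Real.norm_of_nonneg (by positivity)]
  refine mul_le_mul_of_nonneg_right ((norm_mul_one_sub_exp_le hθ hu0.le).trans ?_) (by positivity)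
  exact mul_le_mul_of_nonneg_left (min_le_min_left _ (mul_le_mul_of_nonneg_left hθB hu0.le))
    (norm_nonneg _)

/-- The stable exponent is homogeneous of degree `α`. -/
lemma stableExponent_ofReal_mul {α a : ℝ} (ha : 0 < a) (θ : ℂ) :
    stableExponent α (a * θ) = ((a ^ α : ℝ) : ℂ) * stableExponent α θ := by
  have h := integral_comp_mul_left_Ioi
    (fun u : ℝ ↦ θ * (1 - Complex.exp (-((u : ℂ) * θ))) * ((u ^ (-α) : ℝ) : ℂ)) 0 ha
  rw [mul_zero] at h
  have h2 : stableExponent α θ = a * ∫ u in Set.Ioi (0 : ℝ),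
      θ * (1 - Complex.exp (-(((a * u : ℝ) : ℂ) * θ))) * (((a * u) ^ (-α) : ℝ) : ℂ) := by
    rw [h, Complex.real_smul, ← mul_assoc, ← Complex.ofReal_mul, mul_inv_cancel₀ ha.ne']
    simp [stableExponent]
  rw [h2, ← mul_assoc, ← integral_const_mul, stableExponent]
  refine setIntegral_congr_fun measurableSet_Ioi fun u hu ↦ ?_
  have hu0 : (0 : ℝ) < u := hu
  have h3 : a ^ α * (a * u) ^ (-α) = u ^ (-α) := by
    rw [Real.mul_rpow ha.le hu0.le, ← mul_assoc, ← Real.rpow_add ha]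
    simp
  rw [← h3, show ((u : ℂ) * (a * θ)) = ((a * u : ℝ) : ℂ) * θ by push_cast; ring]
  push_cast
  ring

/-- Integration by parts reduces the constant of the stable law to Euler's integral. -/
lemma setIntegral_one_sub_exp_mul_rpow {α : ℝ} (hα₁ : 1 < α) (hα₂ : α < 2) :
    ∫ u in Set.Ioi (0 : ℝ), (1 - Real.exp (-u)) * u ^ (-α) = Real.Gamma (2 - α) / (α - 1) := by
  have hbound : ∀ u : ℝ, 0 < u → 0 ≤ 1 - Real.exp (-u) ∧ 1 - Real.exp (-u) ≤ min 2 (u * 1) :=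
    fun u hu ↦ by
      have h1 := Real.add_one_le_exp (-u)
      have h2 : Real.exp (-u) ≤ 1 := Real.exp_le_one_iff.2 (by linarith)
      have h3 := Real.exp_pos (-u)
      exact ⟨by linarith, le_min (by linarith) (by linarith)⟩
  have hne : 1 - α ≠ 0 := by linarith
  have hΓ := Real.GammaIntegral_convergent (s := 2 - α) (by linarith)
  have hexp : (2 - α) - 1 = 1 - α := by ring
  rw [hexp] at hΓ
  have h := integral_Ioi_mul_deriv_eq_deriv_mul (a := (0 : ℝ)) (a' := (0 : ℝ)) (b' := 0)
    (u := fun u : ℝ ↦ 1 - Real.exp (-u)) (u' := fun u ↦ Real.exp (-u))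
    (v := fun u : ℝ ↦ u ^ (1 - α) / (1 - α)) (v' := fun u ↦ u ^ (-α))
    (fun u _ ↦ by
      have := ((hasDerivAt_neg u).exp).const_sub 1
      simpa using this)
    (fun u hu ↦ by
      have := (Real.hasDerivAt_rpow_const (p := 1 - α) (Or.inl (ne_of_gt hu))).div_const (1 - α)
      refine this.congr_deriv ?_
      rw [mul_div_assoc, mul_comm, div_mul_cancel₀ _ hne]
      congr 1
      ring)
    (by
      refine (integrableOn_min_mul_rpow zero_le_one hα₁ hα₂).mono'
        (by simp only [Pi.mul_def]; exact (by fun_prop : Measurable _).aestronglyMeasurable) ?_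
      refine (ae_restrict_iff' measurableSet_Ioi).2 (ae_of_all _ fun u hu ↦ ?_)
      have hu0 : (0 : ℝ) < u := hu
      have := hbound u hu0
      simp only [Pi.mul_apply]
      rw [Real.norm_of_nonneg (mul_nonneg this.1 (by positivity))]
      exact mul_le_mul_of_nonneg_right this.2 (by positivity))
    (by
      refine (hΓ.div_const (1 - α)).congr (ae_of_all _ fun u ↦ ?_)
      simp only [Pi.mul_apply]
      ring)
    (by
      have h0 : Tendsto (fun u : ℝ ↦ u ^ (2 - α) / (α - 1)) (𝓝[>] 0) (𝓝 0) := by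
        have := ((Real.continuousAt_rpow_const 0 (2 - α) (Or.inr (by linarith))).tendsto).div_const
          (α - 1)
        rw [Real.zero_rpow (by linarith), zero_div] at this
        exact this.mono_left nhdsWithin_le_nhds
      refine squeeze_zero_norm' ?_ h0
      filter_upwards [self_mem_nhdsWithin] with u hu
      have hu0 : (0 : ℝ) < u := hu
      have hb := hbound u hu0
      simp only [Pi.mul_apply]
      rw [norm_mul, Real.norm_of_nonneg hb.1, norm_div, Real.norm_of_nonneg (by positivity),
        Real.norm_eq_abs, abs_of_neg (by linarith), neg_sub, ← mul_div_assoc]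
      refine div_le_div_of_nonneg_right ?_ (by linarith)
      have : u ^ (2 - α) = u * u ^ (1 - α) := by
        rw [← Real.rpow_one_add' hu0.le (by linarith)]
        congr 1
        ring
      rw [this]
      refine mul_le_mul_of_nonneg_right (hb.2.trans ((min_le_right _ _).trans_eq (mul_one u)))
        (by positivity))
    (by
      have h0 : Tendsto (fun u : ℝ ↦ 2 * (u ^ (-(α - 1)) / (α - 1))) atTop (𝓝 0) := by
        have := ((tendsto_rpow_neg_atTop (by linarith : 0 < α - 1)).div_const (α - 1)).const_mul 2
        simpa using this
      refine squeeze_zero_norm' ?_ h0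
      filter_upwards [eventually_gt_atTop 0] with u hu0
      have hb := hbound u hu0
      simp only [Pi.mul_apply]
      rw [norm_mul, Real.norm_of_nonneg hb.1, norm_div, Real.norm_of_nonneg (by positivity),
        Real.norm_eq_abs, abs_of_neg (by linarith), neg_sub, neg_sub]
      refine mul_le_mul_of_nonneg_right (hb.2.trans (min_le_left _ _)) ?_
      have : 0 < α - 1 := by linarith
      positivity)
  rw [h, Real.Gamma_eq_integral (by linarith), hexp, sub_zero, zero_sub, ← integral_neg,
    ← integral_div]
  refine setIntegral_congr_fun measurableSet_Ioi fun u _ ↦ ?_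
  have : α - 1 ≠ 0 := by linarith
  rw [← neg_sub α 1, div_neg, mul_neg, neg_neg, mul_div_assoc]

lemma stableExponent_ofReal {α : ℝ} (hα₁ : 1 < α) (hα₂ : α < 2) {θ : ℝ} (hθ : 0 ≤ θ) :
    stableExponent α θ = ((Real.Gamma (2 - α) / (α - 1) * θ ^ α : ℝ) : ℂ) := by
  rcases hθ.eq_or_lt with rfl | hθ
  · rw [Complex.ofReal_zero, stableExponent_zero, Real.zero_rpow (by linarith)]
    simp
  · have h1 : stableExponent α 1 = ((Real.Gamma (2 - α) / (α - 1) : ℝ) : ℂ) := by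
      rw [← setIntegral_one_sub_exp_mul_rpow hα₁ hα₂, ← integral_complex_ofReal, stableExponent]
      congr 1
      ext u
      push_cast
      simp
    have h2 := stableExponent_ofReal_mul (α := α) hθ 1
    rw [mul_one, h1] at h2
    rw [h2, ← Complex.ofReal_mul, mul_comm]

/-! ### Convergence of the transforms of the scaled shot noise -/

/-- The linear combination `∑ⱼ sⱼ ℓ(zⱼ - x)` of translates of the response function. -/
noncomputable def superposition {E ι : Type*} [AddCommGroup E] [Fintype ι] (ell : E → ℝ)
    (s : ι → ℝ) (z : ι → E) (x : E) : ℝ :=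
  ∑ j, s j * ell (z j - x)

section Superposition

variable {d : ℕ} {ell : EuclideanSpace ℝ (Fin d) → ℝ} {ι : Type*} [Fintype ι]

lemma measurable_superposition (hm : Measurable ell) (s : ι → ℝ)
    (z : ι → EuclideanSpace ℝ (Fin d)) : Measurable (superposition ell s z) :=
  Finset.measurable_fun_sum _ fun _ _ ↦ (hm.comp (measurable_const.sub measurable_id)).const_mul _

lemma integrable_superposition (hi : Integrable ell) (s : ι → ℝ)
    (z : ι → EuclideanSpace ℝ (Fin d)) : Integrable (superposition ell s z) :=
  integrable_finsetSum _ fun j _ ↦ (hi.comp_sub_left (z j)).const_mul _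

lemma abs_superposition_le (h0 : ∀ x, 0 ≤ ell x) {b : ℝ} (hb : ∀ x, ell x ≤ b) (s : ι → ℝ)
    (z : ι → EuclideanSpace ℝ (Fin d)) (x : EuclideanSpace ℝ (Fin d)) :
    |superposition ell s z x| ≤ (∑ j, |s j|) * b := by
  rw [superposition, Finset.sum_mul]
  refine (Finset.abs_sum_le_sum_abs _ _).trans (Finset.sum_le_sum fun j _ ↦ ?_)
  rw [abs_mul, abs_of_nonneg (h0 _)]
  exact mul_le_mul_of_nonneg_left (hb _) (abs_nonneg _)

lemma superposition_nonneg (h0 : ∀ x, 0 ≤ ell x) {s : ι → ℝ} (hs : ∀ j, 0 ≤ s j)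
    (z : ι → EuclideanSpace ℝ (Fin d)) (x : EuclideanSpace ℝ (Fin d)) :
    0 ≤ superposition ell s z x :=
  Finset.sum_nonneg fun j _ ↦ mul_nonneg (hs j) (h0 _)

lemma superposition_smul (c : ℝ) (s : ι → ℝ) (z : ι → EuclideanSpace ℝ (Fin d))
    (x : EuclideanSpace ℝ (Fin d)) :
    superposition ell (c • s) z x = c * superposition ell s z x := by
  simp only [superposition, Finset.mul_sum, Pi.smul_apply, smul_eq_mul, mul_assoc]

lemma integral_abs_superposition_le (h0 : ∀ x, 0 ≤ ell x) (hi : Integrable ell) (s : ι → ℝ)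
    (z : ι → EuclideanSpace ℝ (Fin d)) :
    ∫ x, |superposition ell s z x| ≤ (∑ j, |s j|) * ∫ x, ell x := by
  have h1 : ∀ j, Integrable fun x ↦ |s j| * ell (z j - x) := fun j ↦
    (hi.comp_sub_left (z j)).const_mul _
  calc ∫ x, |superposition ell s z x| ≤ ∫ x, ∑ j, |s j| * ell (z j - x) := by
        refine integral_mono (integrable_superposition hi s z).abs
          (integrable_finsetSum _ fun j _ ↦ h1 j) fun x ↦ ?_
        refine (Finset.abs_sum_le_sum_abs _ _).trans_eq (Finset.sum_congr rfl fun j _ ↦ ?_)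
        rw [abs_mul, abs_of_nonneg (h0 _)]
    _ = (∑ j, |s j|) * ∫ x, ell x := by
        rw [integral_finsetSum _ fun j _ ↦ h1 j, Finset.sum_mul]
        refine Finset.sum_congr rfl fun j _ ↦ ?_
        rw [integral_const_mul, integral_sub_left_eq_self (fun x ↦ ell x)]

/-- The exponent of the limiting field, for the test function `h`; the parameter `t` is `1` for the
Laplace transform and `-i` for the characteristic function. -/
noncomputable def fieldExponent (α : ℝ) (t : ℂ) (h : EuclideanSpace ℝ (Fin d) → ℝ) : ℂ :=
  ∫ x, stableExponent α (t * h x)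

lemma norm_fieldExponent_le {α : ℝ} (hα₁ : 1 < α) (hα₂ : α < 2) {t : ℂ} (ht : ‖t‖ ≤ 1)
    {h : EuclideanSpace ℝ (Fin d) → ℝ} (hi : Integrable h) (hre : ∀ x, 0 ≤ (t * h x).re) {B : ℝ}
    (hB : 0 ≤ B) (hb : ∀ x, |h x| ≤ B) :
    ‖fieldExponent α t h‖
      ≤ (∫ u in Set.Ioi (0 : ℝ), min 2 (u * B) * u ^ (-α)) * ∫ x, |h x| := by
  have hC : 0 ≤ ∫ u in Set.Ioi (0 : ℝ), min 2 (u * B) * u ^ (-α) :=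
    setIntegral_nonneg measurableSet_Ioi fun u hu ↦ by
      have hu0 : (0 : ℝ) < u := hu
      positivity
  rw [← integral_const_mul]
  refine norm_integral_le_of_norm_le (hi.abs.const_mul _) (ae_of_all _ fun x ↦ ?_)
  have h1 : ‖t * h x‖ ≤ |h x| := by
    rw [norm_mul, Complex.norm_real, Real.norm_eq_abs]
    exact mul_le_of_le_one_left (abs_nonneg _) ht
  exact (norm_stableExponent_le hα₁ hα₂ hB (hre x) (h1.trans (hb x))).trans
    (mul_le_mul_of_nonneg_left h1 hC)

lemma fieldExponent_const_mul {α c : ℝ} (hc : 0 < c) (t : ℂ)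
    (h : EuclideanSpace ℝ (Fin d) → ℝ) :
    fieldExponent α t (fun x ↦ c * h x) = ((c ^ α : ℝ) : ℂ) * fieldExponent α t h := by
  rw [fieldExponent, fieldExponent, ← integral_const_mul]
  congr 1
  ext x
  rw [← stableExponent_ofReal_mul hc]
  congr 1
  push_cast
  ring

lemma fieldExponent_one {α : ℝ} (hα₁ : 1 < α) (hα₂ : α < 2)
    {h : EuclideanSpace ℝ (Fin d) → ℝ} (h0 : ∀ x, 0 ≤ h x) :
    fieldExponent α 1 h = ((Real.Gamma (2 - α) / (α - 1) * ∫ x, h x ^ α : ℝ) : ℂ) := by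
  rw [fieldExponent, ← integral_const_mul, ← integral_complex_ofReal]
  congr 1
  ext x
  rw [one_mul, stableExponent_ofReal hα₁ hα₂ (h0 x)]

lemma integrable_rpow_of_bounded {α : ℝ} (hα₁ : 1 < α)
    {h : EuclideanSpace ℝ (Fin d) → ℝ} (h0 : ∀ x, 0 ≤ h x) (hm : Measurable h)
    (hi : Integrable h) {B : ℝ} (hb : ∀ x, h x ≤ B) : Integrable fun x ↦ h x ^ α := by
  refine (hi.const_mul (B ^ (α - 1))).mono' (hm.pow_const α).aestronglyMeasurable
    (ae_of_all _ fun x ↦ ?_)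
  rw [Real.norm_of_nonneg (Real.rpow_nonneg (h0 x) _)]
  have : h x ^ α = h x ^ (α - 1) * h x := by
    rw [← Real.rpow_add_one' (h0 x) (by linarith)]
    congr 1
    ring
  rw [this]
  exact mul_le_mul_of_nonneg_right (Real.rpow_le_rpow (h0 x) (hb x) (by linarith)) (h0 x)

variable {ν : Measure ℝ} [IsProbabilityMeasure ν]

lemma tendsto_integral_mul_centeredLaplace {α : ℝ} {g : ℝ → ℝ} (hν : ν (Set.Iio 0) = 0)
    (hm : Integrable (fun p : ℝ ↦ p) ν) (hα₁ : 1 < α) (hα₂ : α < 2)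
    (hreg : IsRegularlyVarying (tail ν) (-α))
    (hg : IsAsymptoticInverse g fun t ↦ 1 / tail ν t) {t : ℂ}
    {h : EuclideanSpace ℝ (Fin d) → ℝ} (hhm : Measurable h) (hi : Integrable h)
    (hre : ∀ x, 0 ≤ (t * h x).re) {B : ℝ} (hB : 0 ≤ B) (hb : ∀ x, |h x| ≤ B) :
    Tendsto (fun r : ℝ ↦ ∫ x, (r : ℂ) * centeredLaplace ν (t * h x / g r)) atTop
      (𝓝 (fieldExponent α t h)) := by
  obtain ⟨C, hC, hCb⟩ := exists_norm_mul_centeredLaplace_le hν hm hα₁ hα₂ hreg hg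
    (B := ‖t‖ * B) (by positivity)
  have hnorm : ∀ x, ‖t * h x‖ = ‖t‖ * |h x| := fun x ↦ by
    rw [norm_mul, Complex.norm_real, Real.norm_eq_abs]
  refine tendsto_integral_filter_of_dominated_convergence (fun x ↦ C * (‖t‖ * |h x|))
    (Eventually.of_forall fun r ↦ ?_) ?_ ((hi.abs.const_mul _).const_mul _) ?_
  · have h1 : Measurable (centeredLaplace ν) :=
      ((measurable_complexLaplace ν).sub_const 1).add (measurable_id.const_mul _)
    exact ((h1.comp (by fun_prop)).const_mul _).aestronglyMeasurable
  · filter_upwards [hCb] with r hr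
    refine ae_of_all _ fun x ↦ ?_
    rw [← hnorm]
    refine hr.2 _ (hre x) ?_
    rw [hnorm]
    exact mul_le_mul_of_nonneg_left (hb x) (norm_nonneg _)
  · exact ae_of_all _ fun x ↦ tendsto_mul_centeredLaplace hν hm hα₁ hα₂ hreg hg (hre x)

end Superposition

section ShotNoise

variable {Ω : Type*} [MeasurableSpace Ω] {d : ℕ} {X : ℕ → Ω → EuclideanSpace ℝ (Fin d)}
  {P : ℕ → Ω → ℝ} {lam : ℝ} {ν : Measure ℝ} [IsProbabilityMeasure ν] {μ : Measure Ω}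
  [IsProbabilityMeasure μ] {ell : EuclideanSpace ℝ (Fin d) → ℝ} {ι : Type*} [Fintype ι]

lemma ofReal_shotNoise (z : EuclideanSpace ℝ (Fin d)) (ω : Ω) :
    (shotNoise ell P X z ω : ℂ) = markedSum (fun x ↦ (ell (z - x) : ℂ)) P X ω := by
  rw [shotNoise, Complex.ofReal_tsum, markedSum]
  push_cast
  rfl

lemma measurable_response (hm : Measurable ell) (z : EuclideanSpace ℝ (Fin d)) :
    Measurable fun x ↦ (ell (z - x) : ℂ) :=
  Complex.measurable_ofReal.comp (hm.comp (measurable_const.sub measurable_id))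

lemma integrable_response (hi : Integrable ell) (z : EuclideanSpace ℝ (Fin d)) :
    Integrable fun x ↦ (ell (z - x) : ℂ) :=
  (hi.comp_sub_left z).ofReal

lemma IsMarkedPoisson.ae_summable_shotNoise (h : IsMarkedPoisson X P lam ν μ)
    (hm : Integrable (fun p : ℝ ↦ p) ν) (hem : Measurable ell) (hei : Integrable ell)
    (z : EuclideanSpace ℝ (Fin d)) :
    ∀ᵐ ω ∂μ, Summable fun n ↦ P n ω * ell (z - X n ω) := by
  filter_upwards [h.ae_summable hm (measurable_response hem z) (integrable_response hei z)]
    with ω hω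
  rw [← Complex.summable_ofReal]
  simpa using hω

lemma IsMarkedPoisson.integrable_shotNoise (h : IsMarkedPoisson X P lam ν μ)
    (hm : Integrable (fun p : ℝ ↦ p) ν) (hem : Measurable ell) (hei : Integrable ell)
    (z : EuclideanSpace ℝ (Fin d)) : Integrable (shotNoise ell P X z) μ := by
  refine (h.integrable_markedSum hm (measurable_response hem z) (integrable_response hei
    z)).re.congr (ae_of_all _ fun ω ↦ ?_)
  simp only
  rw [← ofReal_shotNoise]
  simp

lemma IsMarkedPoisson.integral_shotNoise (h : IsMarkedPoisson X P lam ν μ)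
    (hm : Integrable (fun p : ℝ ↦ p) ν) (hem : Measurable ell) (hei : Integrable ell)
    (z : EuclideanSpace ℝ (Fin d)) :
    ∫ ω, shotNoise ell P X z ω ∂μ = (∫ p, p ∂ν) * (lam * ∫ x, ell (z - x)) := by
  have h1 := h.integral_markedSum hm (measurable_response hem z) (integrable_response hei z)
  simp_rw [← ofReal_shotNoise] at h1
  rw [integral_complex_ofReal, integral_complex_ofReal] at h1
  exact_mod_cast h1

/-- Linear combinations of the centred scaled field are centred marked sums. -/
lemma IsMarkedPoisson.sum_mul_scaledShotNoise (h : IsMarkedPoisson X P lam ν μ)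
    (hm : Integrable (fun p : ℝ ↦ p) ν) (hem : Measurable ell) (hei : Integrable ell)
    (s : ι → ℝ) (z : ι → EuclideanSpace ℝ (Fin d)) (a : ℝ) (t : ℂ) :
    ∀ᵐ ω ∂μ, t * ((∑ j, s j * scaledShotNoise ell P X μ a (z j) ω : ℝ) : ℂ)
      = markedSum (fun x ↦ t / a * superposition ell s z x) P X ω
        - t / a * (((∫ p, p ∂ν : ℝ) : ℂ) * (lam * ∫ x, (superposition ell s z x : ℂ))) := by
  have hs := ae_all_iff.2 fun j ↦
    h.ae_summable hm (measurable_response hem (z j)) (integrable_response hei (z j))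
  filter_upwards [hs] with ω hω
  have h1 : markedSum (fun x ↦ t / a * superposition ell s z x) P X ω
      = t / a * ∑ j, (s j : ℂ) * shotNoise ell P X (z j) ω := by
    simp_rw [ofReal_shotNoise]
    simp only [markedSum, superposition]
    simp_rw [← tsum_mul_left]
    rw [← Summable.tsum_finsetSum fun j _ ↦ (hω j).mul_left _, ← tsum_mul_left]
    congr 1
    ext n
    push_cast
    rw [Finset.mul_sum, Finset.mul_sum, Finset.mul_sum]
    exact Finset.sum_congr rfl fun j _ ↦ by ring
  have h2 : (∫ x, (superposition ell s z x : ℂ))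
      = ((∑ j, s j * ∫ x, ell (z j - x) : ℝ) : ℂ) := by
    rw [integral_complex_ofReal]
    congr 1
    simp only [superposition]
    rw [integral_finsetSum _ fun j _ ↦ (hei.comp_sub_left (z j)).const_mul _]
    simp_rw [integral_const_mul]
  rw [h1, h2]
  simp only [scaledShotNoise, h.integral_shotNoise hm hem hei]
  push_cast
  simp only [Finset.mul_sum]
  rw [← Finset.sum_sub_distrib]
  exact Finset.sum_congr rfl fun j _ ↦ by ring

/-- The joint transform of the scaled shot noise at a complex parameter `t`; `t = 1` gives the
Laplace transform, and `t = -i` the characteristic function. Centring turns `L - 1` into the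
centred Laplace transform. -/
theorem IsMarkedPoisson.integral_exp_neg_scaledShotNoise (h : IsMarkedPoisson X P lam ν μ)
    (hν : ν (Set.Iio 0) = 0) (hm : Integrable (fun p : ℝ ↦ p) ν) (hem : Measurable ell)
    (hei : Integrable ell) (s : ι → ℝ) (z : ι → EuclideanSpace ℝ (Fin d)) {a : ℝ} (ha : 0 < a)
    {t : ℂ} (hre : ∀ x, 0 ≤ (t * superposition ell s z x).re) :
    ∫ ω, Complex.exp (-(t * ((∑ j, s j * scaledShotNoise ell P X μ a (z j) ω : ℝ) : ℂ))) ∂μ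
      = Complex.exp (∫ x, (lam : ℂ) * centeredLaplace ν (t * superposition ell s z x / a)) := by
  let w : EuclideanSpace ℝ (Fin d) → ℂ := fun x ↦ t / a * superposition ell s z x
  have hwm : Measurable w :=
    (Complex.measurable_ofReal.comp (measurable_superposition hem s z)).const_mul _
  have hwi : Integrable w := (integrable_superposition hei s z).ofReal.const_mul (t / a : ℂ)
  have hw : ∀ x, t * superposition ell s z x / a = w x := fun x ↦ by
    simp only [w]
    ring
  have hwre : ∀ x, 0 ≤ (w x).re := fun x ↦ by
    rw [← hw, Complex.div_ofReal_re]
    exact div_nonneg (hre x) ha.le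
  have h1 : ∀ᵐ ω ∂μ,
      Complex.exp (-(t * ((∑ j, s j * scaledShotNoise ell P X μ a (z j) ω : ℝ) : ℂ)))
        = Complex.exp (-markedSum w P X ω)
          * Complex.exp (((∫ p, p ∂ν : ℝ) : ℂ) * (lam * ∫ x, w x)) := by
    filter_upwards [h.sum_mul_scaledShotNoise hm hem hei s z a t] with ω hω
    rw [hω, ← Complex.exp_add, integral_const_mul]
    congr 1
    ring
  rw [integral_congr_ae h1, integral_mul_const,
    h.integral_exp_neg_markedSum hν hm hwm hwi hwre, ← Complex.exp_add]
  congr 1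
  simp_rw [hw]
  have h2 : ∫ x, (lam : ℂ) * centeredLaplace ν (w x)
      = lam * ((∫ x, (complexLaplace ν (w x) - 1)) + ((∫ p, p ∂ν : ℝ) : ℂ) * ∫ x, w x) := by
    rw [integral_const_mul]
    congr 1
    rw [← integral_const_mul, ← integral_add
      (integrable_complexLaplace_sub_one hν hm hwm hwi hwre) (hwi.const_mul _)]
    rfl
  rw [h2]
  ring

end ShotNoise

/-! ### Limits of characteristic functions and of Laplace transforms -/

/-- **Lévy's continuity theorem**, existence part: a pointwise limit of characteristic functions
which is continuous at the origin is the characteristic function of a weak limit. -/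
theorem exists_tendsto_of_tendsto_charFun {E : Type*} [NormedAddCommGroup E]
    [InnerProductSpace ℝ E] [FiniteDimensional ℝ E] [MeasurableSpace E] [BorelSpace E]
    {μ : ℕ → ProbabilityMeasure E} {f : E → ℂ} (hf : ContinuousAt f 0)
    (h : ∀ t, Tendsto (fun n ↦ charFun (μ n : Measure E) t) atTop (𝓝 (f t))) :
    ∃ ρ : ProbabilityMeasure E, ∀ t, charFun (ρ : Measure E) t = f t := by
  have htight := isTightMeasureSet_of_tendsto_charFun (μ := fun n ↦ (μ n : Measure E)) hf h
  have hcomp : IsCompact (closure (Set.range μ)) := by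
    refine isCompact_closure_of_isTightMeasureSet ?_
    convert htight using 1
    ext m
    simp
  obtain ⟨ρ, -, hρ⟩ := hcomp.exists_mapClusterPt (u := μ) (f := atTop)
    (le_principal_iff.2 (mem_map.2 (Eventually.of_forall fun n ↦
      subset_closure (Set.mem_range_self n))))
  refine ⟨ρ, fun t ↦ ?_⟩
  have hcont : Continuous fun m : ProbabilityMeasure E ↦ charFun (m : Measure E) t := by
    rw [continuous_iff_continuousAt]
    intro m
    have := (ProbabilityMeasure.tendsto_iff_forall_integral_rclike_tendsto ℂ).1
      (tendsto_id (α := ProbabilityMeasure E) (x := 𝓝 m))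
      (BoundedContinuousFunction.innerProbChar t)
    simp only [ContinuousAt, charFun_eq_integral_innerProbChar]
    exact this
  have h1 : MapClusterPt (charFun (ρ : Measure E) t) atTop fun n ↦ charFun (μ n : Measure E) t :=
    MapClusterPt.continuousAt_comp hcont.continuousAt hρ
  exact eq_of_nhds_neBot (NeBot.mono h1 (inf_le_inf_left _ (h t)))

lemma charFun_map_toLp {Ω ι : Type*} [MeasurableSpace Ω] [Fintype ι] {μ : Measure Ω}
    {Y : Ω → ι → ℝ} (hY : AEMeasurable Y μ) (s : EuclideanSpace ℝ ι) :
    charFun (μ.map fun ω ↦ WithLp.toLp 2 (Y ω)) s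
      = ∫ ω, Complex.exp (-(-Complex.I * ((∑ j, s j * Y ω j : ℝ) : ℂ))) ∂μ := by
  have hm : AEMeasurable (fun ω ↦ WithLp.toLp 2 (Y ω)) μ :=
    (WithLp.measurable_toLp 2 _).comp_aemeasurable hY
  rw [charFun_apply, integral_map hm (by fun_prop)]
  congr 1
  ext ω
  congr 1
  rw [PiLp.inner_apply]
  simp only [RCLike.inner_apply, conj_trivial]
  ring

/-- A finite measure on `ℝ^ι` is determined by its characteristic function. -/
lemma ext_of_forall_integral_exp {ι : Type*} [Fintype ι] {μ ρ : Measure (ι → ℝ)}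
    [IsFiniteMeasure μ] [IsFiniteMeasure ρ]
    (h : ∀ s : ι → ℝ, ∫ y, Complex.exp (-(-Complex.I * ((∑ j, s j * y j : ℝ) : ℂ))) ∂μ
      = ∫ y, Complex.exp (-(-Complex.I * ((∑ j, s j * y j : ℝ) : ℂ))) ∂ρ) : μ = ρ := by
  have h1 : μ.map (WithLp.toLp 2) = ρ.map (WithLp.toLp 2) := by
    refine Measure.ext_of_charFun (funext fun s ↦ ?_)
    have h2 := charFun_map_toLp (μ := μ) (Y := id) aemeasurable_id s
    have h3 := charFun_map_toLp (μ := ρ) (Y := id) aemeasurable_id s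
    exact (h2.trans (h s)).trans h3.symm
  have h4 := congrArg (fun m ↦ m.map WithLp.ofLp) h1
  rw [Measure.map_map (WithLp.measurable_ofLp 2 _) (WithLp.measurable_toLp 2 _),
    Measure.map_map (WithLp.measurable_ofLp 2 _) (WithLp.measurable_toLp 2 _)] at h4
  simpa [Function.comp_def] using h4

/-- If real random variables converge in distribution, the Laplace transforms at `1` converge and
those at `2` stay bounded, then the limit has the limiting Laplace transform at `1`. -/
lemma integral_exp_neg_of_tendstoInDistribution {ι Ω' : Type*} {Ω : ι → Type*}
    [∀ i, MeasurableSpace (Ω i)] [MeasurableSpace Ω'] {μ : ∀ i, Measure (Ω i)}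
    [∀ i, IsProbabilityMeasure (μ i)] {μ' : Measure Ω'} [IsProbabilityMeasure μ']
    {l : Filter ι} [l.NeBot] {Y : ∀ i, Ω i → ℝ} {Z : Ω' → ℝ}
    (hYZ : TendstoInDistribution Y l Z μ μ') {L C : ℝ}
    (h1 : Tendsto (fun i ↦ ∫ ω, Real.exp (-Y i ω) ∂(μ i)) l (𝓝 L))
    (hi1 : ∀ᶠ i in l, Integrable (fun ω ↦ Real.exp (-Y i ω)) (μ i))
    (hi2 : ∀ᶠ i in l, Integrable (fun ω ↦ Real.exp (-(2 * Y i ω))) (μ i))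
    (h2 : ∀ᶠ i in l, ∫ ω, Real.exp (-(2 * Y i ω)) ∂(μ i) ≤ C) :
    Integrable (fun ω ↦ Real.exp (-Z ω)) μ' ∧ ∫ ω, Real.exp (-Z ω) ∂μ' = L := by
  -- truncated exponentials are bounded and continuous
  have hφb : ∀ (M : ℕ) (x : ℝ), 0 ≤ min (Real.exp (-x)) M ∧ min (Real.exp (-x)) M ≤ M :=
    fun M x ↦ ⟨le_min (Real.exp_pos _).le (Nat.cast_nonneg M), min_le_right _ _⟩
  have hφc : ∀ M : ℕ, Continuous fun x : ℝ ↦ min (Real.exp (-x)) (M : ℝ) := fun M ↦ by fun_prop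
  let φ : ℕ → BoundedContinuousFunction ℝ ℝ := fun M ↦
    BoundedContinuousFunction.ofNormedAddCommGroup (fun x ↦ min (Real.exp (-x)) M) (hφc M) M
      fun x ↦ by
        rw [Real.norm_of_nonneg (hφb M x).1]
        exact (hφb M x).2
  have hYm := hYZ.forall_aemeasurable
  have hZm := hYZ.aemeasurable_limit
  have hconv : ∀ M : ℕ, Tendsto (fun i ↦ ∫ ω, min (Real.exp (-Y i ω)) M ∂(μ i)) l
      (𝓝 (∫ ω, min (Real.exp (-Z ω)) M ∂μ')) := fun M ↦ by
    have h := ProbabilityMeasure.tendsto_iff_forall_integral_tendsto.1 hYZ.tendsto (φ M)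
    simp only [ProbabilityMeasure.coe_mk] at h
    rw [integral_map hZm (φ M).continuous.aestronglyMeasurable] at h
    simp_rw [fun i ↦ integral_map (hYm i)
      (φ M).continuous.aestronglyMeasurable] at h
    exact h
  have htrunc : ∀ (M : ℕ) {Ω₀ : Type _} [MeasurableSpace Ω₀] {m : Measure Ω₀}
      [IsProbabilityMeasure m] {W : Ω₀ → ℝ}, AEMeasurable W m →
      Integrable (fun ω ↦ min (Real.exp (-W ω)) (M : ℝ)) m := by
    intro M Ω₀ _ m _ W hW
    refine (integrable_const (M : ℝ)).mono'
      ((hφc M).measurable.comp_aemeasurable hW).aestronglyMeasurable (ae_of_all _ fun ω ↦ ?_)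
    rw [Real.norm_of_nonneg (hφb M _).1]
    exact (hφb M _).2
  have htruncZ : ∀ M : ℕ, Integrable (fun ω ↦ min (Real.exp (-Z ω)) (M : ℝ)) μ' := by
    intro M
    refine (integrable_const (M : ℝ)).mono'
      ((hφc M).measurable.comp_aemeasurable hZm).aestronglyMeasurable (ae_of_all _ fun ω ↦ ?_)
    rw [Real.norm_of_nonneg (hφb M _).1]
    exact (hφb M _).2
  have hle : ∀ M : ℕ, ∫ ω, min (Real.exp (-Z ω)) M ∂μ' ≤ L := fun M ↦ by
    refine le_of_tendsto_of_tendsto (hconv M) h1 ?_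
    filter_upwards [hi1] with i hi
    exact integral_mono (htrunc M (hYm i)) hi fun ω ↦ min_le_left _ _
  -- the truncation error is controlled by the second transform: `x - min x M ≤ x ^ 2 / M`
  have hge : ∀ M : ℕ, 0 < M → L ≤ ∫ ω, min (Real.exp (-Z ω)) M ∂μ' + C / M := fun M hM ↦ by
    refine le_of_tendsto_of_tendsto h1 ((hconv M).add_const (C / M)) ?_
    filter_upwards [hi1, hi2, h2] with i hi hi' hC
    have hM' : (0 : ℝ) < M := Nat.cast_pos.2 hM
    have h3 : ∫ ω, Real.exp (-Y i ω) ∂(μ i) ≤ ∫ ω, (min (Real.exp (-Y i ω)) M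
        + Real.exp (-(2 * Y i ω)) / M) ∂(μ i) := by
      refine integral_mono hi ((htrunc M (hYm i)).add (hi'.div_const _)) fun ω ↦ ?_
      have hsq : Real.exp (-(2 * Y i ω)) = Real.exp (-Y i ω) * Real.exp (-Y i ω) := by
        rw [← Real.exp_add]
        congr 1
        ring
      simp only
      rw [hsq]
      have hpos := Real.exp_pos (-Y i ω)
      rcases le_total (Real.exp (-Y i ω)) M with hc | hc
      · rw [min_eq_left hc]
        exact le_add_of_nonneg_right (by positivity)
      · refine le_trans ?_ (le_add_of_nonneg_left (hφb M _).1)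
        rw [le_div_iff₀ hM']
        exact mul_le_mul_of_nonneg_left hc hpos.le
    refine h3.trans ?_
    rw [integral_add (htrunc M (hYm i)) (hi'.div_const _), integral_div]
    gcongr
  have hmono : ∀ᵐ ω ∂μ', Monotone fun M : ℕ ↦ min (Real.exp (-Z ω)) (M : ℝ) :=
    ae_of_all _ fun ω a b hab ↦ min_le_min_left _ (Nat.cast_le.2 hab)
  have hlim : ∀ᵐ ω ∂μ', Tendsto (fun M : ℕ ↦ min (Real.exp (-Z ω)) (M : ℝ)) atTop
      (𝓝 (Real.exp (-Z ω))) := ae_of_all _ fun ω ↦ by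
    refine tendsto_const_nhds.congr' ?_
    filter_upwards [tendsto_natCast_atTop_atTop.eventually_ge_atTop (Real.exp (-Z ω))] with M hM
    rw [min_eq_left hM]
  have hint : Integrable (fun ω ↦ Real.exp (-Z ω)) μ' := by
    refine ⟨(Real.continuous_exp.measurable.comp_aemeasurable hZm.neg).aestronglyMeasurable, ?_⟩
    have h5 : ∀ M : ℕ, ∫⁻ ω, ‖min (Real.exp (-Z ω)) (M : ℝ)‖ₑ ∂μ' ≤ ENNReal.ofReal L := fun M ↦ by
      rw [← ofReal_integral_norm_eq_lintegral_enorm (htruncZ M)]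
      refine ENNReal.ofReal_le_ofReal ?_
      simp_rw [fun ω ↦ Real.norm_of_nonneg (hφb M (Z ω)).1]
      exact hle M
    have h6 : ∫⁻ ω, ‖Real.exp (-Z ω)‖ₑ ∂μ'
        ≤ liminf (fun M : ℕ ↦ ∫⁻ ω, ‖min (Real.exp (-Z ω)) (M : ℝ)‖ₑ ∂μ') atTop := by
      rw [← lintegral_congr_ae (hlim.mono fun ω hω ↦ hω.enorm.liminf_eq)]
      exact lintegral_liminf_le' fun M ↦ (htruncZ M).aestronglyMeasurable.enorm
    refine (h6.trans (liminf_le_liminf (Eventually.of_forall h5))).trans_lt ?_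
    rw [liminf_const]
    exact ENNReal.ofReal_lt_top
  refine ⟨hint, ?_⟩
  have hmct := integral_tendsto_of_tendsto_of_monotone htruncZ hint hmono hlim
  refine le_antisymm (le_of_tendsto' hmct hle) ?_
  have h4 : Tendsto (fun M : ℕ ↦ ∫ ω, min (Real.exp (-Z ω)) (M : ℝ) ∂μ' + C / M) atTop
      (𝓝 (∫ ω, Real.exp (-Z ω) ∂μ' + 0)) :=
    hmct.add (tendsto_const_nhds.div_atTop tendsto_natCast_atTop_atTop)
  rw [add_zero] at h4
  refine ge_of_tendsto h4 ?_
  filter_upwards [eventually_gt_atTop 0] with M hM using hge M hM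

/-! ### The limiting field -/

section LimitField

variable {d : ℕ} {ell : EuclideanSpace ℝ (Fin d) → ℝ} {α : ℝ}

lemma re_neg_I_mul_ofReal_nonneg (x : ℝ) : 0 ≤ (-Complex.I * (x : ℂ)).re := by simp

lemma measurable_exp_sum {ι κ : Type*} [Fintype ι] (s : ι → ℝ) (φ : ι → κ) :
    Measurable fun y : κ → ℝ ↦
      Complex.exp (-(-Complex.I * ((∑ j, s j * y (φ j) : ℝ) : ℂ))) :=
  Complex.measurable_exp.comp ((Complex.measurable_ofReal.comp
    (Finset.measurable_fun_sum _ fun _ _ ↦ (measurable_pi_apply _).const_mul _)).const_mul _).neg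

/-- A linear combination of coordinates with repetitions is one over distinct coordinates. -/
lemma sum_fiberwise_mul {ι κ : Type*} [Fintype ι] [Fintype κ] [DecidableEq κ] (φ : ι → κ)
    (s : ι → ℝ) (y : κ → ℝ) :
    ∑ k, (∑ j with φ j = k, s j) * y k = ∑ j, s j * y (φ j) := by
  rw [← Finset.sum_fiberwise (s := Finset.univ) (g := φ)]
  refine Finset.sum_congr rfl fun k _ ↦ ?_
  rw [Finset.sum_mul]
  exact Finset.sum_congr rfl fun j hj ↦ by rw [(Finset.mem_filter.1 hj).2]

/-- Lévy's theorem asks the limiting characteristic function to be continuous at the origin. -/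
lemma continuousAt_exp_fieldExponent (hα₁ : 1 < α) (hα₂ : α < 2)
    (h0 : ∀ x, 0 ≤ ell x) (hbdd : ∃ b : ℝ, ∀ x, ell x ≤ b) (hei : Integrable ell)
    {ι : Type*} [Fintype ι] (z : ι → EuclideanSpace ℝ (Fin d)) :
    ContinuousAt (fun s : EuclideanSpace ℝ ι ↦
      Complex.exp (fieldExponent α (-Complex.I) (superposition ell s z))) 0 := by
  obtain ⟨b, hb⟩ := hbdd
  have hb0 : 0 ≤ b := (h0 0).trans (hb 0)
  refine Complex.continuous_exp.continuousAt.comp ?_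
  have hzero : fieldExponent α (-Complex.I)
      (superposition ell ((0 : EuclideanSpace ℝ ι) : ι → ℝ) z) = 0 := by
    simp [fieldExponent, superposition, stableExponent_zero]
  rw [ContinuousAt, hzero]
  set B : ℝ := (∑ _j : ι, 1) * b with hBdef
  have hB : 0 ≤ B := by positivity
  set C : ℝ := ∫ u in Set.Ioi (0 : ℝ), min 2 (u * B) * u ^ (-α) with hC
  have hC0 : 0 ≤ C := setIntegral_nonneg measurableSet_Ioi fun u hu ↦ by
    have hu0 : (0 : ℝ) < u := hu
    positivity
  have hlim : Tendsto (fun s : EuclideanSpace ℝ ι ↦ C * ((∑ j, |s j|) * ∫ x, ell x)) (𝓝 0)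
      (𝓝 0) := by
    have hc : Continuous fun s : EuclideanSpace ℝ ι ↦ C * ((∑ j, |s j|) * ∫ x, ell x) := by
      fun_prop
    have := hc.tendsto 0
    simpa using this
  refine squeeze_zero_norm' ?_ hlim
  have hsmall : ∀ᶠ s : EuclideanSpace ℝ ι in 𝓝 0, ∀ j, |s j| ≤ 1 := by
    refine eventually_all.2 fun j ↦ ?_
    have hc : Continuous fun s : EuclideanSpace ℝ ι ↦ |s j| := by fun_prop
    have := (hc.tendsto 0).eventually_le_const (u := 1) (by simp)
    exact this
  filter_upwards [hsmall] with s hs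
  refine (norm_fieldExponent_le hα₁ hα₂ (by simp) (integrable_superposition hei s z)
    (fun x ↦ re_neg_I_mul_ofReal_nonneg _) hB fun x ↦ ?_).trans
    (mul_le_mul_of_nonneg_left (integral_abs_superposition_le h0 hei s z) hC0)
  refine (abs_superposition_le h0 hb s z x).trans (mul_le_mul_of_nonneg_right ?_ hb0)
  exact Finset.sum_le_sum fun j _ ↦ hs j

/-- Finite-dimensional laws with the characteristic functions of the limiting field form a
projective family, as these functions determine them, and so extend to the space of all functions.
-/
theorem exists_measure_of_forall_exists_law
    (hlaw : ∀ J : Finset (EuclideanSpace ℝ (Fin d)), ∃ ρ : Measure (J → ℝ),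
      IsProbabilityMeasure ρ ∧ ∀ s : J → ℝ,
        ∫ y, Complex.exp (-(-Complex.I * ((∑ j, s j * y j : ℝ) : ℂ))) ∂ρ
          = Complex.exp (fieldExponent α (-Complex.I)
            (superposition ell s fun j : J ↦ (j : EuclideanSpace ℝ (Fin d))))) :
    ∃ Q : Measure (EuclideanSpace ℝ (Fin d) → ℝ), IsProbabilityMeasure Q ∧
      ∀ (m : ℕ) (s : Fin m → ℝ) (z : Fin m → EuclideanSpace ℝ (Fin d)),
        ∫ ω, Complex.exp (-(-Complex.I * ((∑ j, s j * ω (z j) : ℝ) : ℂ))) ∂Q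
          = Complex.exp (fieldExponent α (-Complex.I) (superposition ell s z)) := by
  classical
  choose ρ hρ hchar using hlaw
  -- a linear combination of coordinates is one over any larger set of distinct coordinates
  have hsup : ∀ {ι : Type} [Fintype ι] (J : Finset (EuclideanSpace ℝ (Fin d))) (φ : ι → J)
      (s : ι → ℝ), ∫ y, Complex.exp (-(-Complex.I * ((∑ j, s j * y (φ j) : ℝ) : ℂ))) ∂(ρ J)
        = Complex.exp (fieldExponent α (-Complex.I)
          (superposition ell s fun j ↦ (φ j : EuclideanSpace ℝ (Fin d)))) := by
    intro ι _ J φ s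
    have h := hchar J fun k ↦ ∑ j with φ j = k, s j
    simp_rw [sum_fiberwise_mul φ s] at h
    rw [h]
    congr 2
    ext x
    exact sum_fiberwise_mul φ s fun k : J ↦ ell (k - x)
  have hproj : IsProjectiveMeasureFamily (α := fun _ : EuclideanSpace ℝ (Fin d) ↦ ℝ) ρ := by
    intro I J hJI
    have hm : Measurable (Finset.restrict₂ (π := fun _ : EuclideanSpace ℝ (Fin d) ↦ ℝ) hJI) :=
      Finset.measurable_restrict₂ hJI
    have : IsProbabilityMeasure ((ρ I).map
        (Finset.restrict₂ (π := fun _ : EuclideanSpace ℝ (Fin d) ↦ ℝ) hJI)) :=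
      Measure.isProbabilityMeasure_map hm.aemeasurable
    refine ext_of_forall_integral_exp fun s ↦ ?_
    rw [integral_map hm.aemeasurable
      (measurable_exp_sum s _).aestronglyMeasurable, hchar J s]
    exact (hsup I (fun j : J ↦ ⟨j, hJI j.2⟩) s).symm
  obtain ⟨Q, hQ, hlim⟩ := exists_isProjectiveLimit ρ hproj
  refine ⟨Q, hQ, fun m s z ↦ ?_⟩
  let J := Finset.univ.image z
  have h := hsup J (fun j : Fin m ↦ ⟨z j, Finset.mem_image_of_mem z (Finset.mem_univ j)⟩) s
  rw [← h, ← hlim J, integral_map (Finset.measurable_restrict J).aemeasurable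
    (measurable_exp_sum s _).aestronglyMeasurable]
  rfl

/-- The limiting field is `α`-stable, because its exponent is homogeneous of degree `α`. -/
theorem isStableField_of_forall_integral_exp (hα : 0 < α)
    {Q : Measure (EuclideanSpace ℝ (Fin d) → ℝ)} [IsProbabilityMeasure Q]
    (hQ : ∀ (m : ℕ) (s : Fin m → ℝ) (z : Fin m → EuclideanSpace ℝ (Fin d)),
      ∫ ω, Complex.exp (-(-Complex.I * ((∑ j, s j * ω (z j) : ℝ) : ℂ))) ∂Q
        = Complex.exp (fieldExponent α (-Complex.I) (superposition ell s z))) :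
    IsStableField α (fun z ω ↦ ω z) Q := by
  intro m z A B hA hB
  refine ⟨0, ?_⟩
  have hzm : Measurable fun (ω : EuclideanSpace ℝ (Fin d) → ℝ) (j : Fin m) ↦ ω (z j) := by
    fun_prop
  set ρ := Q.map fun ω j ↦ ω (z j) with hρ
  have hρp : IsProbabilityMeasure ρ := Measure.isProbabilityMeasure_map hzm.aemeasurable
  have hφ : ∀ s : Fin m → ℝ, ∫ y, Complex.exp (-(-Complex.I * ((∑ j, s j * y j : ℝ) : ℂ))) ∂ρ
      = Complex.exp (fieldExponent α (-Complex.I) (superposition ell s z)) := fun s ↦ by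
    rw [hρ, integral_map hzm.aemeasurable (measurable_exp_sum s _).aestronglyMeasurable]
    exact hQ m s z
  have hscale : ∀ {c : ℝ}, 0 < c → ∀ s : Fin m → ℝ,
      ∫ y, Complex.exp (-(-Complex.I * ((∑ j, (c • s) j * y j : ℝ) : ℂ))) ∂ρ
        = Complex.exp (((c ^ α : ℝ) : ℂ)
          * fieldExponent α (-Complex.I) (superposition ell s z)) := fun {c} hc s ↦ by
    rw [hφ, ← fieldExponent_const_mul hc]
    congr 3
    ext x
    exact superposition_smul c s z x
  set c : ℝ := (A ^ α + B ^ α) ^ (1 / α) with hc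
  have hAB : 0 < A ^ α + B ^ α := by positivity
  have hc0 : 0 < c := Real.rpow_pos_of_pos hAB _
  have hcα : c ^ α = A ^ α + B ^ α := by
    rw [hc, ← Real.rpow_mul hAB.le, one_div_mul_cancel hα.ne', Real.rpow_one]
  have hm1 : Measurable fun p : (Fin m → ℝ) × (Fin m → ℝ) ↦ A • p.1 + B • p.2 := by fun_prop
  have hm2 : Measurable fun y : Fin m → ℝ ↦ c • y + 0 := by fun_prop
  have hp1 := Measure.isProbabilityMeasure_map (μ := ρ.prod ρ) hm1.aemeasurable
  have hp2 := Measure.isProbabilityMeasure_map (μ := ρ) hm2.aemeasurable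
  refine ext_of_forall_integral_exp fun s ↦ ?_
  rw [integral_map hm1.aemeasurable (measurable_exp_sum s _).aestronglyMeasurable,
    integral_map hm2.aemeasurable (measurable_exp_sum s _).aestronglyMeasurable]
  have h1 : ∀ p : (Fin m → ℝ) × (Fin m → ℝ),
      Complex.exp (-(-Complex.I * ((∑ j, s j * (A • p.1 + B • p.2) j : ℝ) : ℂ)))
        = Complex.exp (-(-Complex.I * ((∑ j, (A • s) j * p.1 j : ℝ) : ℂ)))
          * Complex.exp (-(-Complex.I * ((∑ j, (B • s) j * p.2 j : ℝ) : ℂ))) := fun p ↦ by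
    rw [← Complex.exp_add]
    congr 1
    have : ∑ j, s j * (A • p.1 + B • p.2) j
        = ∑ j, (A • s) j * p.1 j + ∑ j, (B • s) j * p.2 j := by
      rw [← Finset.sum_add_distrib]
      refine Finset.sum_congr rfl fun j _ ↦ ?_
      simp only [Pi.add_apply, Pi.smul_apply, smul_eq_mul]
      ring
    rw [this]
    push_cast
    ring
  have h2 : ∀ y : Fin m → ℝ, ∑ j, s j * (c • y + 0) j = ∑ j, (c • s) j * y j := fun y ↦ by
    refine Finset.sum_congr rfl fun j _ ↦ ?_
    simp only [add_zero, Pi.smul_apply, smul_eq_mul]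
    ring
  simp_rw [h1, h2]
  rw [integral_prod_mul (fun y : Fin m → ℝ ↦
      Complex.exp (-(-Complex.I * ((∑ j, (A • s) j * y j : ℝ) : ℂ))))
    (fun y : Fin m → ℝ ↦ Complex.exp (-(-Complex.I * ((∑ j, (B • s) j * y j : ℝ) : ℂ)))),
    hscale hA, hscale hB, hscale hc0, ← Complex.exp_add, hcα]
  congr 1
  push_cast
  ring

end LimitField

section Convergence

variable {d : ℕ} {ell : EuclideanSpace ℝ (Fin d) → ℝ} {α : ℝ} {ν : Measure ℝ}
  [IsProbabilityMeasure ν] {g : ℝ → ℝ} {Ω : Set.Ioi (0 : ℝ) → Type*}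
  [∀ lam, MeasurableSpace (Ω lam)] {μ : ∀ lam, Measure (Ω lam)}
  [∀ lam, IsProbabilityMeasure (μ lam)] {X : ∀ lam, ℕ → Ω lam → EuclideanSpace ℝ (Fin d)}
  {P : ∀ lam, ℕ → Ω lam → ℝ}

lemma IsMarkedPoisson.aemeasurable_scaledShotNoise {Ω : Type*} [MeasurableSpace Ω]
    {X : ℕ → Ω → EuclideanSpace ℝ (Fin d)} {P : ℕ → Ω → ℝ} {lam : ℝ} {μ : Measure Ω}
    [IsProbabilityMeasure μ] (h : IsMarkedPoisson X P lam ν μ)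
    (hm : Integrable (fun p : ℝ ↦ p) ν) (hem : Measurable ell) (hei : Integrable ell)
    {ι : Type*} [Fintype ι] (z : ι → EuclideanSpace ℝ (Fin d)) (a : ℝ) :
    AEMeasurable (fun ω j ↦ scaledShotNoise ell P X μ a (z j) ω) μ :=
  aemeasurable_pi_iff.2 fun j ↦
    ((h.integrable_shotNoise hm hem hei (z j)).aemeasurable.sub_const _).div_const _

lemma tendsto_integral_exp_neg_scaledShotNoise
    (hM : ∀ lam : Set.Ioi (0 : ℝ), IsMarkedPoisson (X lam) (P lam) lam ν (μ lam))
    (hν : ν (Set.Iio 0) = 0) (hm : Integrable (fun p : ℝ ↦ p) ν) (hα₁ : 1 < α) (hα₂ : α < 2)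
    (hreg : IsRegularlyVarying (tail ν) (-α))
    (hg : IsAsymptoticInverse g fun t ↦ 1 / tail ν t) (hem : Measurable ell)
    (h0 : ∀ x, 0 ≤ ell x) (hbdd : ∃ b : ℝ, ∀ x, ell x ≤ b) (hei : Integrable ell)
    {ι : Type*} [Fintype ι] (s : ι → ℝ) (z : ι → EuclideanSpace ℝ (Fin d)) {t : ℂ}
    (hre : ∀ x, 0 ≤ (t * superposition ell s z x).re) :
    Tendsto (fun lam : Set.Ioi (0 : ℝ) ↦ ∫ ω, Complex.exp (-(t * ((∑ j, s j *
        scaledShotNoise ell (P lam) (X lam) (μ lam) (g lam) (z j) ω : ℝ) : ℂ))) ∂(μ lam)) atTop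
      (𝓝 (Complex.exp (fieldExponent α t (superposition ell s z)))) := by
  obtain ⟨b, hb⟩ := hbdd
  have hb0 : 0 ≤ b := (h0 0).trans (hb 0)
  have h1 := tendsto_integral_mul_centeredLaplace hν hm hα₁ hα₂ hreg hg
    (measurable_superposition hem s z) (integrable_superposition hei s z) hre
    (B := (∑ j, |s j|) * b) (by positivity) (abs_superposition_le h0 hb s z)
  have hcoe : Tendsto (fun lam : Set.Ioi (0 : ℝ) ↦ (lam : ℝ)) atTop atTop :=
    tendsto_comp_val_Ioi_atTop.2 tendsto_id
  have h2 := (Complex.continuous_exp.tendsto _).comp (h1.comp hcoe)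
  refine h2.congr' ?_
  have hgpos := (tendsto_atTop_of_isAsymptoticInverse antitone_tail (tail_pos hreg)
    hg).eventually_gt_atTop 0
  filter_upwards [hcoe.eventually hgpos] with lam hlam
  exact ((hM lam).integral_exp_neg_scaledShotNoise hν hm hem hei s z hlam hre).symm

/-- The finite-dimensional laws of the limiting field, as weak limits along integer intensities. -/
lemma exists_law_of_isMarkedPoisson
    (hM : ∀ lam : Set.Ioi (0 : ℝ), IsMarkedPoisson (X lam) (P lam) lam ν (μ lam))
    (hν : ν (Set.Iio 0) = 0) (hm : Integrable (fun p : ℝ ↦ p) ν) (hα₁ : 1 < α) (hα₂ : α < 2)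
    (hreg : IsRegularlyVarying (tail ν) (-α))
    (hg : IsAsymptoticInverse g fun t ↦ 1 / tail ν t) (hem : Measurable ell)
    (h0 : ∀ x, 0 ≤ ell x) (hbdd : ∃ b : ℝ, ∀ x, ell x ≤ b) (hei : Integrable ell)
    {ι : Type*} [Fintype ι] (z : ι → EuclideanSpace ℝ (Fin d)) :
    ∃ ρ : Measure (ι → ℝ), IsProbabilityMeasure ρ ∧ ∀ s : ι → ℝ,
      ∫ y, Complex.exp (-(-Complex.I * ((∑ j, s j * y j : ℝ) : ℂ))) ∂ρ
        = Complex.exp (fieldExponent α (-Complex.I) (superposition ell s z)) := by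
  let u : ℕ → Set.Ioi (0 : ℝ) := fun n ↦ ⟨n + 1, by simp only [Set.mem_Ioi]; positivity⟩
  have hu : Tendsto u atTop atTop := by
    refine tendsto_Ioi_atTop.2 ?_
    exact tendsto_atTop_add_const_right _ _ tendsto_natCast_atTop_atTop
  have hY := fun lam : Set.Ioi (0 : ℝ) ↦
    (hM lam).aemeasurable_scaledShotNoise hm hem hei z (g lam)
  have hY' := fun lam : Set.Ioi (0 : ℝ) ↦ (WithLp.measurable_toLp 2 _).comp_aemeasurable (hY lam)
  obtain ⟨ρ, hρ⟩ := exists_tendsto_of_tendsto_charFun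
    (μ := fun n ↦ (⟨(μ (u n)).map fun ω ↦ WithLp.toLp 2 fun j ↦
      scaledShotNoise ell (P (u n)) (X (u n)) (μ (u n)) (g (u n)) (z j) ω,
      Measure.isProbabilityMeasure_map (hY' (u n))⟩ : ProbabilityMeasure (EuclideanSpace ℝ ι)))
    (continuousAt_exp_fieldExponent hα₁ hα₂ h0 hbdd hei z) (fun s ↦ by
      simp only [ProbabilityMeasure.coe_mk]
      simp_rw [fun n ↦ charFun_map_toLp (hY (u n)) s]
      exact (tendsto_integral_exp_neg_scaledShotNoise hM hν hm hα₁ hα₂ hreg hg hem h0 hbdd hei s z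
        (fun x ↦ re_neg_I_mul_ofReal_nonneg _)).comp hu)
  have hofLp : Measurable (WithLp.ofLp : EuclideanSpace ℝ ι → ι → ℝ) := WithLp.measurable_ofLp 2 _
  refine ⟨(ρ : Measure (EuclideanSpace ℝ ι)).map WithLp.ofLp,
    Measure.isProbabilityMeasure_map hofLp.aemeasurable, fun s ↦ ?_⟩
  rw [integral_map hofLp.aemeasurable (measurable_exp_sum s _).aestronglyMeasurable]
  have h1 := charFun_map_toLp (μ := (ρ : Measure (EuclideanSpace ℝ ι))) (Y := WithLp.ofLp)
    hofLp.aemeasurable (WithLp.toLp 2 s)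
  have h2 := hρ (WithLp.toLp 2 s)
  simp only [WithLp.toLp_ofLp, Measure.map_id'] at h1
  rw [← h1, h2]

lemma tendstoInFDD_scaledShotNoise
    (hM : ∀ lam : Set.Ioi (0 : ℝ), IsMarkedPoisson (X lam) (P lam) lam ν (μ lam))
    (hν : ν (Set.Iio 0) = 0) (hm : Integrable (fun p : ℝ ↦ p) ν) (hα₁ : 1 < α) (hα₂ : α < 2)
    (hreg : IsRegularlyVarying (tail ν) (-α))
    (hg : IsAsymptoticInverse g fun t ↦ 1 / tail ν t) (hem : Measurable ell)
    (h0 : ∀ x, 0 ≤ ell x) (hbdd : ∃ b : ℝ, ∀ x, ell x ≤ b) (hei : Integrable ell)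
    {Q : Measure (EuclideanSpace ℝ (Fin d) → ℝ)} [IsProbabilityMeasure Q]
    (hQ : ∀ (m : ℕ) (s : Fin m → ℝ) (z : Fin m → EuclideanSpace ℝ (Fin d)),
      ∫ ω, Complex.exp (-(-Complex.I * ((∑ j, s j * ω (z j) : ℝ) : ℂ))) ∂Q
        = Complex.exp (fieldExponent α (-Complex.I) (superposition ell s z))) :
    TendstoInFDD (fun lam : Set.Ioi (0 : ℝ) ↦
      scaledShotNoise ell (P lam) (X lam) (μ lam) (g lam)) atTop (fun z ω ↦ ω z) μ Q := by
  intro m z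
  have hY := fun lam : Set.Ioi (0 : ℝ) ↦
    (hM lam).aemeasurable_scaledShotNoise hm hem hei z (g lam)
  have hZ : AEMeasurable (fun (ω : EuclideanSpace ℝ (Fin d) → ℝ) (j : Fin m) ↦ ω (z j)) Q :=
    (measurable_pi_iff.2 fun j ↦ measurable_pi_apply (z j)).aemeasurable
  have hvec : TendstoInDistribution (fun (lam : Set.Ioi (0 : ℝ)) ω ↦ WithLp.toLp 2 fun j ↦
      scaledShotNoise ell (P lam) (X lam) (μ lam) (g lam) (z j) ω) atTop
      (fun ω ↦ WithLp.toLp 2 fun j ↦ ω (z j)) μ Q :=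
    { forall_aemeasurable := fun lam ↦ (WithLp.measurable_toLp 2 _).comp_aemeasurable (hY lam)
      aemeasurable_limit := (WithLp.measurable_toLp 2 _).comp_aemeasurable hZ
      tendsto := by
        refine tendsto_of_seq_tendsto fun u hu ↦ ?_
        refine ProbabilityMeasure.tendsto_iff_tendsto_charFun.2 fun s ↦ ?_
        have key : Tendsto (fun n ↦ charFun ((μ (u n)).map fun ω ↦ WithLp.toLp 2 fun j ↦
            scaledShotNoise ell (P (u n)) (X (u n)) (μ (u n)) (g (u n)) (z j) ω) s) atTop
            (𝓝 (charFun (Q.map fun ω ↦ WithLp.toLp 2 fun j ↦ ω (z j)) s)) := by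
          rw [charFun_map_toLp hZ s, hQ m s z]
          simp_rw [fun n ↦ charFun_map_toLp (hY (u n)) s]
          exact (tendsto_integral_exp_neg_scaledShotNoise hM hν hm hα₁ hα₂ hreg hg hem h0 hbdd
            hei s z (fun x ↦ re_neg_I_mul_ofReal_nonneg _)).comp hu
        exact key }
  exact hvec.continuous_comp (PiLp.continuous_ofLp 2 _)

/-- The Laplace transform of the limiting field; the second moments of the exponentials are Laplace
transforms at `2 s`, and these converge as well. -/
lemma integral_exp_neg_of_tendstoInFDD
    (hM : ∀ lam : Set.Ioi (0 : ℝ), IsMarkedPoisson (X lam) (P lam) lam ν (μ lam))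
    (hν : ν (Set.Iio 0) = 0) (hm : Integrable (fun p : ℝ ↦ p) ν) (hα₁ : 1 < α) (hα₂ : α < 2)
    (hreg : IsRegularlyVarying (tail ν) (-α))
    (hg : IsAsymptoticInverse g fun t ↦ 1 / tail ν t) (hem : Measurable ell)
    (h0 : ∀ x, 0 ≤ ell x) (hbdd : ∃ b : ℝ, ∀ x, ell x ≤ b) (hei : Integrable ell)
    {Q : Measure (EuclideanSpace ℝ (Fin d) → ℝ)} [IsProbabilityMeasure Q]
    (hconv : TendstoInFDD (fun lam : Set.Ioi (0 : ℝ) ↦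
      scaledShotNoise ell (P lam) (X lam) (μ lam) (g lam)) atTop (fun z ω ↦ ω z) μ Q)
    {m : ℕ} {s : Fin m → ℝ} (hs : ∀ j, 0 ≤ s j) (z : Fin m → EuclideanSpace ℝ (Fin d)) :
    Integrable (fun ω ↦ Real.exp (-∑ j, s j * ω (z j))) Q ∧
      ∫ ω, Real.exp (-∑ j, s j * ω (z j)) ∂Q
        = Real.exp (Real.Gamma (2 - α) / (α - 1) * ∫ x, superposition ell s z x ^ α) := by
  have hreal : ∀ {s : Fin m → ℝ}, (∀ j, 0 ≤ s j) →
      Tendsto (fun lam : Set.Ioi (0 : ℝ) ↦ ∫ ω, Real.exp (-∑ j, s j *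
        scaledShotNoise ell (P lam) (X lam) (μ lam) (g lam) (z j) ω) ∂(μ lam)) atTop
      (𝓝 (Real.exp (Real.Gamma (2 - α) / (α - 1) * ∫ x, superposition ell s z x ^ α))) := by
    intro s hs
    have h1 := tendsto_integral_exp_neg_scaledShotNoise hM hν hm hα₁ hα₂ hreg hg hem h0 hbdd hei
      s z (t := 1) (fun x ↦ by simpa using superposition_nonneg h0 hs z x)
    rw [fieldExponent_one hα₁ hα₂ (superposition_nonneg h0 hs z), ← Complex.ofReal_exp] at h1
    have h2 := (Complex.continuous_re.tendsto _).comp h1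
    rw [Complex.ofReal_re] at h2
    refine h2.congr fun lam ↦ ?_
    simp only [Function.comp_apply, one_mul]
    rw [← Complex.ofReal_re (∫ ω, Real.exp (-∑ j, s j *
        scaledShotNoise ell (P lam) (X lam) (μ lam) (g lam) (z j) ω) ∂(μ lam)),
      ← integral_complex_ofReal]
    simp_rw [Complex.ofReal_exp, Complex.ofReal_neg]
  have hint : ∀ {s : Fin m → ℝ}, (∀ j, 0 ≤ s j) → ∀ᶠ lam : Set.Ioi (0 : ℝ) in atTop,
      Integrable (fun ω ↦ Real.exp (-∑ j, s j *
        scaledShotNoise ell (P lam) (X lam) (μ lam) (g lam) (z j) ω)) (μ lam) := by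
    intro s hs
    filter_upwards [(hreal hs).eventually_const_lt (Real.exp_pos _)] with lam hlam
    -- a vanishing integral is excluded by the positive limit, so the integrand is integrable
    by_contra hni
    rw [integral_undef hni] at hlam
    exact lt_irrefl _ hlam
  have h2s : ∀ j, 0 ≤ (2 * s j) := fun j ↦ mul_nonneg zero_le_two (hs j)
  have hdouble : ∀ y : Fin m → ℝ, ∑ j, 2 * s j * y j = 2 * ∑ j, s j * y j := fun y ↦ by
    rw [Finset.mul_sum]
    exact Finset.sum_congr rfl fun j _ ↦ by ring
  have hlin := (hconv m z).continuous_comp (g := fun y : Fin m → ℝ ↦ ∑ j, s j * y j) (by fun_prop)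
  have hi2 := hint h2s
  have hb2 := (hreal h2s).eventually_le_const (lt_add_one _)
  simp_rw [hdouble] at hi2 hb2
  exact integral_exp_neg_of_tendstoInDistribution hlin (hreal hs) (hint hs) hi2 hb2

end Convergence

theorem theorem2 {d : ℕ} (hd : 1 ≤ d)
    -- the response function
    (ell : EuclideanSpace ℝ (Fin d) → ℝ) (hell_meas : Measurable ell)
    (hell_nonneg : ∀ x, 0 ≤ ell x) (hell_bdd : ∃ b : ℝ, ∀ x, ell x ≤ b)
    (hell_int : Integrable ell volume)
    -- the amplitude distribution, and the scaling function
    (ν : Measure ℝ) [IsProbabilityMeasure ν] (hν_nonneg : ν (Set.Iio 0) = 0)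
    (hν_mean : Integrable (fun t : ℝ => t) ν)
    (α : ℝ) (hα₁ : 1 < α) (hα₂ : α < 2) (hν_tail : IsRegularlyVarying (tail ν) (-α))
    (g : ℝ → ℝ) (hg : IsAsymptoticInverse g (fun t => 1 / tail ν t))
    -- for every intensity, i.i.d. amplitudes independent of a homogeneous Poisson process
    (Ω : Set.Ioi (0 : ℝ) → Type*) [∀ lam, MeasurableSpace (Ω lam)]
    (μ : ∀ lam, Measure (Ω lam)) [∀ lam, IsProbabilityMeasure (μ lam)]
    (X : ∀ lam, ℕ → Ω lam → EuclideanSpace ℝ (Fin d))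
    (hX : ∀ lam, IsHomogeneousPoisson (X lam) lam (μ lam))
    (P : ∀ lam, ℕ → Ω lam → ℝ)
    (hP_law : ∀ lam n, HasLaw (P lam n) ν (μ lam))
    (hP_indep : ∀ lam, iIndepFun (P lam) (μ lam))
    (hPX : ∀ lam, IndepFun (fun ω n => P lam n ω) (fun ω n => X lam n ω) (μ lam)) :
    IsRegularlyVarying g (1 / α) ∧
    -- the series converge almost surely and the centring constants are finite
    (∀ lam z, (∀ᵐ ω ∂(μ lam), Summable fun n => P lam n ω * ell (z - X lam n ω)) ∧
      Integrable (shotNoise ell (P lam) (X lam) z) (μ lam)) ∧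
    ∃ (Ω' : Type) (_ : MeasurableSpace Ω') (μ' : Measure Ω') (_ : IsProbabilityMeasure μ')
      (S : EuclideanSpace ℝ (Fin d) → Ω' → ℝ),
      (∀ z, Measurable (S z)) ∧
      IsStableField α S μ' ∧
      TendstoInFDD
        (fun lam => scaledShotNoise ell (P lam) (X lam) (μ lam) (g lam)) atTop S μ μ' ∧
      ∀ (m : ℕ) (s : Fin m → ℝ) (z : Fin m → EuclideanSpace ℝ (Fin d)), (∀ j, 0 ≤ s j) →
        Integrable (fun ω => Real.exp (-∑ j, s j * S (z j) ω)) μ' ∧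
        Integrable (fun x => (∑ j, s j * ell (z j - x)) ^ α) volume ∧
        ∫ ω, Real.exp (-∑ j, s j * S (z j) ω) ∂μ'
          = Real.exp (Real.Gamma (2 - α) / (α - 1)
              * ∫ x, (∑ j, s j * ell (z j - x)) ^ α) := by
  have hM : ∀ lam : Set.Ioi (0 : ℝ), IsMarkedPoisson (X lam) (P lam) lam ν (μ lam) := fun lam ↦
    ⟨hX lam, lam.2, hP_law lam, hP_indep lam, hPX lam⟩
  refine ⟨isRegularlyVarying_asymptoticInverse (by linarith) (tail_pos hν_tail) hν_tail
    antitone_tail hg, fun lam z ↦ ⟨(hM lam).ae_summable_shotNoise hν_mean hell_meas hell_int z,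
    (hM lam).integrable_shotNoise hν_mean hell_meas hell_int z⟩, ?_⟩
  obtain ⟨Q, hQ, hchar⟩ := exists_measure_of_forall_exists_law (α := α) (ell := ell) fun J ↦
    exists_law_of_isMarkedPoisson hM hν_nonneg hν_mean hα₁ hα₂ hν_tail hg hell_meas hell_nonneg
      hell_bdd hell_int fun j : J ↦ (j : EuclideanSpace ℝ (Fin d))
  have hconv := tendstoInFDD_scaledShotNoise hM hν_nonneg hν_mean hα₁ hα₂ hν_tail hg hell_meas
    hell_nonneg hell_bdd hell_int hchar
  refine ⟨EuclideanSpace ℝ (Fin d) → ℝ, inferInstance, Q, hQ, fun z ω ↦ ω z,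
    fun z ↦ measurable_pi_apply z, isStableField_of_forall_integral_exp (by linarith) hchar, hconv,
    fun m s z hs ↦ ?_⟩
  have hlap := integral_exp_neg_of_tendstoInFDD hM hν_nonneg hν_mean hα₁ hα₂ hν_tail hg hell_meas
    hell_nonneg hell_bdd hell_int hconv hs z
  obtain ⟨b, hb⟩ := hell_bdd
  exact ⟨hlap.1, integrable_rpow_of_bounded hα₁ (superposition_nonneg hell_nonneg hs z)
    (measurable_superposition hell_meas s z) (integrable_superposition hell_int s z)
    fun x ↦ (le_abs_self _).trans (abs_superposition_le hell_nonneg hb s z x), hlap.2⟩
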